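/- **Theorem (total truncation error of the barycentric shifted Gegenbauer pseudospectral discretization of the integral diffusion equation).** *Setting.* Let $L,t_f>0$, $\alpha>-\tfrac12$, and let $N_y,N_t\ge 1$ be integers. Let $G^{(\alpha)}_0=1$, $G^{(\alpha)}_1=x$, $(n+2\alpha)G^{(\alpha)}_{n+1}=2(n+\alpha)xG^{(\alpha)}_n-nG^{(\alpha)}_{n-1}$ $(n\ge1)$ be the Gegenbauer polynomials, and $G^{(\alpha)}_{l,n}(x)=G^{(\alpha)}_n(2x/l-1)$ the shifted ones on $[0,l]$. Let $x_{l,n,0}<\dots<x_{l,n,n}$ be the zeros of $G^{(\alpha)}_{l,n+1}$ (the SGG nodes), let $\varpi_{l,n,i}$ be their Christoffel numbers for the weight $(x(l-x))^{\alpha-1/2}$ on $[0,l]$, and put $$\xi_{l,n,i}=2(-1)^i\sqrt{4^{\alpha}l^{-2(1+\alpha)}(l-x_{l,n,i})\,x_{l,n,i}\,\varpi_{l,n,i}},\qquad \mathcal L_{l,n,k}(x)=\frac{\xi_{l,n,k}}{x-x_{l,n,k}}\Big/\sum_{j=0}^n\frac{\xi_{l,n,j}}{x-x_{l,n,j}}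 .$$ The $q$-th order integration matrix ${}_lP^{(q)}_n$ has the entries $${}_lp^{(q)}_{n,i,k}=\frac{(x_{l,n,i}-x_{l,n,k})^{q-1}}{(q-1)!}\int_0^{x_{l,n,i}}\mathcal L_{l,n,k}(x)\,dx .$$ Write $y_i=x_{L,N_y,i}$ and $t_j=x_{t_f,N_t,j}$. Let $\phi,u$ be real functions on $[0,L]\times[0,t_f]$, let $f$ be a real function on $[0,L]$, and set $\psi(y,t)=\phi(0,t)-\phi(y,t)+u(0,t)-u(y,t)$. The integral diffusion equation $$\int_0^{y}\!\int_0^{\sigma_1}\phi(\sigma_0,t)\,d\sigma_0\,d\sigma_1+\int_0^{t}\psi(y,\sigma)\,d\sigma=f(y)-f(0)$$ is discretized at $(y_i,t_j)$ by $$\sum_{s=0}^{N_y}{}_Lp^{(2)}_{N_y,i,s}\,\phi(y_s,t_j)+\sum_{k=0}^{N_t}{}_{t_f}p^{(1)}_{N_t,j,k}\,\psi(y_i,t_k)=f(y_i)-f(0).$$ The total truncation error $E_{\mathrm{total},i,j}$ is the residual (left side minus right side) of the integral equation at $(y_i,t_j)$ minus the residual of the discrete equation. *Hypotheses.* Suppose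 that $\psi(y,\cdot)\in C^{N_t+1}[0,t_f]$ for every $y\in[0,L]$, and that the partial derivatives $\partial^k\phi/\partial y^k$, $0\le k\le N_y+1$, exist on $[0,L]\times[0,t_f]$ and satisfy there $|\partial^k\phi/\partial y^k|\le A_{\max}$ for some $A_{\max}>0$. *Conclusion.* There exist $\zeta^y_i\in(0,L)$, $0\le i\le N_y$, and $\zeta^t_j\in(0,t_f)$, $0\le j\le N_t$, such that for all positive numbers $B_{\max,j}$ with $$\sup_{0\le y\le L}\Big|\frac{\partial^{N_t+1}\psi}{\partial t^{N_t+1}}(y,\zeta^t_j)\Big|\le B_{\max,j},\qquad 0\le j\le N_t,$$ one has, for all $0\le i\le N_y$ and $0\le j\le N_t$, $$|E_{\mathrm{total},i,j}|\le D^{(\alpha)}(\varepsilon_{1,j}+\varepsilon_{2,i}),\qquad D^{(\alpha)}=\frac{\Gamma(1+\alpha)}{2\,\Gamma(1+2\alpha)},$$ where $$\varepsilon_{1,j}=\frac{4^{-N_t}B_{\max,j}\,t_f^{N_t+1}\,t_j}{(N_t+1)!\,\Gamma(N_t+\alpha+1)}\cdot\begin{cases}\Gamma(N_t+2\alpha+1),&\alpha\ge0,\\[4pt]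 \dfrac{-2\alpha\binom{N_t/2+\alpha}{N_t/2}(N_t+1)!\,|\Gamma(2\alpha)|}{\sqrt{(N_t+1)(N_t+2\alpha+1)}},&N_t\text{ even},\ -\tfrac12<\alpha<0,\\[10pt] \left|\binom{(N_t-1)/2+\alpha}{(N_t+1)/2}\right|(N_t+1)!\,|\Gamma(2\alpha)|,&N_t\text{ odd},\ -\tfrac12<\alpha<0,\end{cases}$$ $$\varepsilon_{2,i}=\frac{A_{\max}\,n_{\max,i}\,2^{1-N_y}\,y_i\,L^{N_y+1}\,\Gamma(N_y+2\alpha+1)}{(N_y+1)!\,\Gamma(1+N_y+\alpha)}\cdot\begin{cases}1,&\alpha\ge0,\\[4pt] \dfrac{2|\alpha|\left|\binom{N_y/2+\alpha}{N_y/2}\right|(N_y+1)!\,|\Gamma(2\alpha)|}{\sqrt{(N_y+1)(N_y+2\alpha+1)}\,\Gamma(N_y+2\alpha+1)},&N_y\text{ even},\ -\tfrac12<\alpha<0,\\[10pt] \dfrac{\left|\binom{(N_y-1)/2+\alpha}{(N_y+1)/2}\right|(N_y+1)!\,|\Gamma(2\alpha)|}{\Gamma(N_y+2\alpha+1)},&N_y\text{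 odd},\ -\tfrac12<\alpha<0,\end{cases}$$ and $n_{\max,i}=\max\{1,|y_i-\zeta^y_i|\}$. Here $\binom{r}{m}=r(r-1)\cdots(r-m+1)/m!$ for real $r$ and integers $m\ge0$. -/

import Mathlib

open Polynomial Set

noncomputable section

namespace BSGPM

/-- The Gegenbauer polynomials with parameter `α`, standardized by `G_n(1) = 1`:
`G_0 = 1`, `G_1 = X` and `(n + 2 α) G_{n+1} = 2 (n + α) X G_n - n G_{n-1}` for `n ≥ 1`.
For `α = 0` these are the Chebyshev polynomials of the first kind. -/
def gegenbauer (α : ℝ) : ℕ → ℝ[X]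
  | 0 => 1
  | 1 => X
  | n + 2 =>
      C (((n : ℝ) + 1 + 2 * α)⁻¹) *
        (C (2 * ((n : ℝ) + 1 + α)) * X * gegenbauer α (n + 1) -
          C ((n : ℝ) + 1) * gegenbauer α n)

/-- The shifted Gegenbauer polynomial `G_{l,n}(x) = G_n(2 x / l - 1)` on `[0, l]`. -/
def shiftedGegenbauer (l α : ℝ) (n : ℕ) : ℝ[X] :=
  (gegenbauer α n).comp (C (2 / l) * X - 1)

/-- The shifted Gegenbauer-Gauss nodes `x_{l,n,0} < ⋯ < x_{l,n,n}`: the zeros of `G_{l,n+1}`,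
sorted ascendingly. -/
def node (l α : ℝ) (n : ℕ) (i : Fin (n + 1)) : ℝ :=
  ((shiftedGegenbauer l α (n + 1)).roots.sort).getD i 0

/-- The Christoffel numbers: the weights of the interpolatory (Gauss) quadrature at the nodes
for the weight function `(x (l - x)) ^ (α - 1/2)` on `[0, l]`. -/
def christoffel (l α : ℝ) (n : ℕ) (i : Fin (n + 1)) : ℝ :=
  ∫ x in (0 : ℝ)..l, (x * (l - x)) ^ (α - 1 / 2) *
    (Lagrange.basis Finset.univ (node l α n) i).eval x

/-- The shifted barycentric weights `ξ_{l,n,i}`. -/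
def baryWeight (l α : ℝ) (n : ℕ) (i : Fin (n + 1)) : ℝ :=
  2 * (-1) ^ (i : ℕ) *
    Real.sqrt ((4 : ℝ) ^ α * l ^ (-2 * (1 + α)) * (l - node l α n i) * node l α n i *
      christoffel l α n i)

/-- The barycentric form of the `k`-th Lagrange interpolating polynomial at the nodes. The formula
is meaningful away from the finitely many nodes; below it only occurs under an integral. -/
def baryLagrange (l α : ℝ) (n : ℕ) (k : Fin (n + 1)) (x : ℝ) : ℝ :=
  baryWeight l α n k / (x - node l α n k) /
    ∑ j : Fin (n + 1), baryWeight l α n j / (x - node l α n j)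

/-- The first-order barycentric shifted Gegenbauer integration matrix: entry `(i, k)` is the
integral over `[0, x_i]` of the `k`-th Lagrange interpolating polynomial. -/
def integMatrixOne (l α : ℝ) (n : ℕ) (i k : Fin (n + 1)) : ℝ :=
  ∫ x in (0 : ℝ)..(node l α n i), baryLagrange l α n k x

/-- The `q`-th order barycentric shifted Gegenbauer integration matrix (`q ≥ 1`), with entries
`(x_i - x_k)^(q-1) / (q-1)!` times those of the first-order matrix. -/
def integMatrix (l α : ℝ) (n q : ℕ) (i k : Fin (n + 1)) : ℝ :=
  (node l α n i - node l α n k) ^ (q - 1) / ((q - 1).factorial : ℝ) * integMatrixOne l α n i k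

/-- The `q`-fold iterated integral from `0`. -/
def iterInt : ℕ → (ℝ → ℝ) → ℝ → ℝ
  | 0, g => g
  | q + 1, g => fun x => ∫ s in (0 : ℝ)..x, iterInt q g s

/-- `ψ(y,t) = φ(0,t) - φ(y,t) + u(0,t) - u(y,t)`. -/
def psi (φ u : ℝ → ℝ → ℝ) (y t : ℝ) : ℝ := φ 0 t - φ y t + u 0 t - u y t

/-- Left-hand side minus right-hand side, at `(y,t)`, of the integral diffusion equation
`I₂^{(y)} φ + I₁^{(t)} (φ(0,t) - φ(y,t) + u(0,t) - u(y,t)) = f(y) - f(0)`. -/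
def integralResidual (f : ℝ → ℝ) (φ u : ℝ → ℝ → ℝ) (y t : ℝ) : ℝ :=
  iterInt 2 (fun s => φ s t) y + iterInt 1 (fun s => psi φ u y s) t - (f y - f 0)

/-- Left-hand side minus right-hand side of the discrete integral diffusion equation at the
grid point `(y_i, t_j)`. -/
def discreteResidual (L tf α : ℝ) (Ny Nt : ℕ) (f : ℝ → ℝ) (φ u : ℝ → ℝ → ℝ)
    (i : Fin (Ny + 1)) (j : Fin (Nt + 1)) : ℝ :=
  ∑ s : Fin (Ny + 1), integMatrix L α Ny 2 i s * φ (node L α Ny s) (node tf α Nt j) +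
    ∑ k : Fin (Nt + 1), integMatrix tf α Nt 1 j k *
      psi φ u (node L α Ny i) (node tf α Nt k) -
    (f (node L α Ny i) - f 0)

/-- The total truncation error of the discretization at the grid point `(y_i, t_j)`. -/
def totalError (L tf α : ℝ) (Ny Nt : ℕ) (f : ℝ → ℝ) (φ u : ℝ → ℝ → ℝ)
    (i : Fin (Ny + 1)) (j : Fin (Nt + 1)) : ℝ :=
  integralResidual f φ u (node L α Ny i) (node tf α Nt j) -
    discreteResidual L tf α Ny Nt f φ u i j

/-- `D^{(α)} = Γ(1+α) / (2 Γ(1+2α))`. -/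
def constD (α : ℝ) : ℝ := Real.Gamma (1 + α) / (2 * Real.Gamma (1 + 2 * α))

/-- `ε_{1,j}`, as a function of the bound `B = B_{max,j}` and the node `t = t_j`. -/
def eps1 (α tf : ℝ) (N : ℕ) (B t : ℝ) : ℝ :=
  (4 : ℝ)⁻¹ ^ N * B * tf ^ (N + 1) * t /
      (((N + 1).factorial : ℝ) * Real.Gamma ((N : ℝ) + α + 1)) *
    (if 0 ≤ α then Real.Gamma ((N : ℝ) + 2 * α + 1)
     else if Even N then
      -(2 * α * Ring.choose ((N : ℝ) / 2 + α) (N / 2) * ((N + 1).factorial : ℝ) *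
          |Real.Gamma (2 * α)|) /
        Real.sqrt (((N : ℝ) + 1) * ((N : ℝ) + 2 * α + 1))
     else
      |Ring.choose (((N : ℝ) - 1) / 2 + α) ((N + 1) / 2)| * ((N + 1).factorial : ℝ) *
        |Real.Gamma (2 * α)|)

/-- `n_{max,i} = max {1, |y_i - ζ_i|}`, as a function of `y = y_i` and `ζ = ζ_i`. -/
def nMax (y ζ : ℝ) : ℝ := max 1 |y - ζ|

/-- `ε_{2,i}`, as a function of `A = A_max`, of `m = n_{max,i}` and of the node `y = y_i`. -/
def eps2 (α L : ℝ) (N : ℕ) (A m y : ℝ) : ℝ :=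
  A * m * (2 : ℝ) ^ (1 - (N : ℤ)) * y * L ^ (N + 1) * Real.Gamma ((N : ℝ) + 2 * α + 1) /
      (((N + 1).factorial : ℝ) * Real.Gamma (1 + (N : ℝ) + α)) *
    (if 0 ≤ α then 1
     else if Even N then
      2 * |α| * |Ring.choose ((N : ℝ) / 2 + α) (N / 2)| * ((N + 1).factorial : ℝ) *
          |Real.Gamma (2 * α)| /
        (Real.sqrt (((N : ℝ) + 1) * ((N : ℝ) + 2 * α + 1)) *
          Real.Gamma ((N : ℝ) + 2 * α + 1))
     else
      |Ring.choose (((N : ℝ) - 1) / 2 + α) ((N + 1) / 2)| * ((N + 1).factorial : ℝ) *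
          |Real.Gamma (2 * α)| /
        Real.Gamma ((N : ℝ) + 2 * α + 1))

end BSGPM

end

namespace BSGPM

/-! ### Rolle's theorem, the interpolation error, the quadrature error -/

/-- Rolle's theorem for a function with several zeros. -/
theorem exists_strictMono_zeros_deriv {m : ℕ} {z : Fin (m + 2) → ℝ} (hz : StrictMono z)
    {F F' : ℝ → ℝ} (hc : ContinuousOn F (Icc (z 0) (z (Fin.last _))))
    (hd : ∀ x ∈ Ioo (z 0) (z (Fin.last _)), HasDerivAt F (F' x) x) (h0 : ∀ i, F (z i) = 0) :
    ∃ y : Fin (m + 1) → ℝ, StrictMono y ∧ (∀ i, y i ∈ Ioo (z 0) (z (Fin.last _))) ∧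
      ∀ i, F' (y i) = 0 := by
  have key : ∀ i : Fin (m + 1), ∃ c ∈ Ioo (z i.castSucc) (z i.succ), F' c = 0 := by
    intro i
    have h1 : z 0 ≤ z i.castSucc := hz.monotone (Fin.zero_le _)
    have h2 : z i.succ ≤ z (Fin.last _) := hz.monotone (Fin.le_last _)
    refine exists_hasDerivAt_eq_zero (hz Fin.castSucc_lt_succ)
      (hc.mono (Icc_subset_Icc h1 h2)) ((h0 _).trans (h0 _).symm) ?_
    exact fun x hx => hd x (Ioo_subset_Ioo h1 h2 hx)
  choose y hy hy0 using key
  refine ⟨y, ?_, fun i => ?_, hy0⟩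
  · refine Fin.strictMono_iff_lt_succ.2 fun i => ?_
    have h1 := (hy i.castSucc).2
    have h2 := (hy i.succ).1
    rw [Fin.succ_castSucc] at h1
    exact h1.trans h2
  · exact Ioo_subset_Ioo (hz.monotone (Fin.zero_le _)) (hz.monotone (Fin.le_last _)) (hy i)

/-- The generalized Rolle theorem, for a function `d 0` with successive derivatives `d k`. -/
theorem exists_zero_of_strictMono_zeros {a b : ℝ} {m : ℕ} {d : ℕ → ℝ → ℝ}
    (hc : ∀ k ≤ m, ContinuousOn (d k) (Icc a b))
    (hd : ∀ k ≤ m, ∀ x ∈ Ioo a b, HasDerivAt (d k) (d (k + 1) x) x)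
    {z : Fin (m + 2) → ℝ} (hz : StrictMono z) (hzm : ∀ i, z i ∈ Icc a b)
    (h0 : ∀ i, d 0 (z i) = 0) : ∃ ζ ∈ Ioo a b, d (m + 1) ζ = 0 := by
  induction m generalizing d with
  | zero =>
    obtain ⟨y, -, hy, hy0⟩ := exists_strictMono_zeros_deriv hz
      ((hc 0 le_rfl).mono (Icc_subset_Icc (hzm _).1 (hzm _).2))
      (fun x hx => hd 0 le_rfl x (Ioo_subset_Ioo (hzm _).1 (hzm _).2 hx)) h0
    exact ⟨y 0, Ioo_subset_Ioo (hzm _).1 (hzm _).2 (hy 0), hy0 0⟩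
  | succ m ih =>
    obtain ⟨y, hy, hym, hy0⟩ := exists_strictMono_zeros_deriv hz
      ((hc 0 (Nat.zero_le _)).mono (Icc_subset_Icc (hzm _).1 (hzm _).2))
      (fun x hx => hd 0 (Nat.zero_le _) x (Ioo_subset_Ioo (hzm _).1 (hzm _).2 hx)) h0
    exact ih (d := fun k => d (k + 1)) (fun k hk => hc (k + 1) (by omega))
      (fun k hk => hd (k + 1) (by omega)) hy
      (fun i => Ioo_subset_Icc_self (Ioo_subset_Ioo (hzm _).1 (hzm _).2 (hym i))) hy0

theorem iterate_derivative_of_natDegree_le {p : ℝ[X]} {n : ℕ} (hp : p.natDegree ≤ n) :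
    derivative^[n] p = C ((n.factorial : ℝ) * p.coeff n) := by
  have h := natDegree_iterate_derivative p n
  rw [eq_C_of_natDegree_le_zero (h.trans (by omega)), coeff_iterate_derivative]
  simp [Nat.descFactorial_self]

/-- The error of Lagrange interpolation, for a function `d 0` with successive derivatives `d k`. -/
theorem exists_interpolation_error_eq {N : ℕ} {l : ℝ} (hl : 0 < l) {d : ℕ → ℝ → ℝ}
    (hd : ∀ k ≤ N, ∀ x ∈ Icc 0 l, HasDerivWithinAt (d k) (d (k + 1) x) (Icc 0 l) x)
    {v : Fin (N + 1) → ℝ} (hv : Function.Injective v) (hvm : ∀ i, v i ∈ Icc 0 l)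
    {x : ℝ} (hx : x ∈ Icc 0 l) :
    ∃ ζ ∈ Ioo 0 l,
      d 0 x - (Lagrange.interpolate Finset.univ v fun i => d 0 (v i)).eval x =
        d (N + 1) ζ / ((N + 1).factorial : ℝ) * ∏ i, (x - v i) := by
  set p := Lagrange.interpolate Finset.univ v fun i => d 0 (v i) with hp
  have hpv : ∀ i, p.eval (v i) = d 0 (v i) := fun i =>
    Lagrange.eval_interpolate_at_node _ hv.injOn (Finset.mem_univ i)
  by_cases hxv : ∃ i, x = v i
  · obtain ⟨i, rfl⟩ := hxv
    refine ⟨l / 2, ⟨by linarith, by linarith⟩, ?_⟩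
    rw [hpv, Finset.prod_eq_zero (Finset.mem_univ i) (sub_self _)]
    simp
  push Not at hxv
  set w := Lagrange.nodal Finset.univ v with hw
  have hwx : w.eval x = ∏ i, (x - v i) := Lagrange.eval_nodal
  have hw0 : w.eval x ≠ 0 := Lagrange.eval_nodal_not_at_node fun i _ => hxv i
  set c := (d 0 x - p.eval x) / w.eval x with hcdef
  set P := p + C c * w with hP
  have hPd : ∀ k y, HasDerivAt (fun s => (derivative^[k] P).eval s)
      ((derivative^[k + 1] P).eval y) y := by
    intro k y
    rw [Function.iterate_succ_apply']
    exact Polynomial.hasDerivAt _ _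
  let S : Finset ℝ := insert x (Finset.univ.image v)
  have hS : S.card = N + 2 := by
    rw [Finset.card_insert_of_notMem, Finset.card_image_of_injective _ hv]
    · simp
    · simpa using fun i => (hxv i).symm
  have hzS : ∀ i, S.orderEmbOfFin hS i ∈ S := fun i => Finset.orderEmbOfFin_mem _ _ _
  have hSmem : ∀ s ∈ S, s ∈ Icc 0 l ∧ d 0 s - P.eval s = 0 := by
    intro s hs
    rcases Finset.mem_insert.1 hs with rfl | hs
    · refine ⟨hx, ?_⟩
      simp only [hP, eval_add, eval_mul, eval_C, hcdef]
      field_simp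
      ring
    · obtain ⟨i, -, rfl⟩ := Finset.mem_image.1 hs
      refine ⟨hvm i, ?_⟩
      simp only [hP, eval_add, eval_mul, eval_C, hpv]
      rw [hw, Lagrange.eval_nodal_at_node (Finset.mem_univ i)]
      ring
  obtain ⟨ζ, hζ, h0⟩ := exists_zero_of_strictMono_zeros (a := 0) (b := l) (m := N)
    (d := fun k s => d k s - (derivative^[k] P).eval s)
    (fun k hk s hs => ((hd k hk s hs).continuousWithinAt).sub
      (Polynomial.continuous _).continuousWithinAt)
    (fun k hk s hs => ((hd k hk s (Ioo_subset_Icc_self hs)).hasDerivAt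
      (Icc_mem_nhds hs.1 hs.2)).sub (hPd k s))
    (S.orderEmbOfFin hS).strictMono (fun i => (hSmem _ (hzS i)).1) (fun i => (hSmem _ (hzS i)).2)
  refine ⟨ζ, hζ, ?_⟩
  have hpdeg : p.degree < ((N + 1 : ℕ) : WithBot ℕ) := by
    have h := Lagrange.degree_interpolate_lt (fun i => d 0 (v i)) hv.injOn (s := Finset.univ)
    rwa [Finset.card_univ, Fintype.card_fin] at h
  have hwdeg : w.natDegree = N + 1 := by simp [hw, Lagrange.natDegree_nodal]
  have hwc : w.coeff (N + 1) = 1 := by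
    rw [← hwdeg]
    exact Lagrange.nodal_monic
  have hPdeg : P.natDegree ≤ N + 1 := by
    refine (natDegree_add_le _ _).trans (max_le (natDegree_le_of_degree_le hpdeg.le) ?_)
    exact (natDegree_C_mul_le _ _).trans hwdeg.le
  rw [iterate_derivative_of_natDegree_le hPdeg, hP, coeff_add, coeff_C_mul, hwc,
    coeff_eq_zero_of_degree_lt hpdeg, eval_C, zero_add, mul_one] at h0
  rw [← hwx, sub_eq_zero.1 h0, hcdef]
  have : ((N + 1).factorial : ℝ) ≠ 0 := by positivity
  field_simp

/-- The error of an interpolatory quadrature on `[0, τ]`. -/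
theorem exists_abs_quadrature_error_le {N : ℕ} {l : ℝ} (hl : 0 < l) {d : ℕ → ℝ → ℝ}
    (hd : ∀ k ≤ N, ∀ x ∈ Icc 0 l, HasDerivWithinAt (d k) (d (k + 1) x) (Icc 0 l) x)
    {v : Fin (N + 1) → ℝ} (hv : Function.Injective v) (hvm : ∀ i, v i ∈ Icc 0 l)
    {M : ℝ} (hM : ∀ x ∈ Icc 0 l, |∏ i, (x - v i)| ≤ M) {τ : ℝ} (hτ : τ ∈ Icc 0 l) :
    ∃ ζ ∈ Ioo 0 l,
      |(∫ x in (0 : ℝ)..τ, d 0 x) -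
          ∑ k, (∫ x in (0 : ℝ)..τ, (Lagrange.basis Finset.univ v k).eval x) * d 0 (v k)| ≤
        |d (N + 1) ζ| / ((N + 1).factorial : ℝ) * M * τ := by
  set p := Lagrange.interpolate Finset.univ v fun i => d 0 (v i) with hp
  have hc : ContinuousOn (d 0) (Icc 0 τ) := fun x hx =>
    ((hd 0 (Nat.zero_le _) x ⟨hx.1, hx.2.trans hτ.2⟩).continuousWithinAt).mono
      (Icc_subset_Icc_right hτ.2)
  have hsum : ∑ k, (∫ x in (0 : ℝ)..τ, (Lagrange.basis Finset.univ v k).eval x) * d 0 (v k) =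
      ∫ x in (0 : ℝ)..τ, p.eval x := by
    simp only [hp, Lagrange.interpolate_apply, eval_finsetSum, eval_mul, eval_C]
    rw [intervalIntegral.integral_finsetSum]
    · refine Finset.sum_congr rfl fun k _ => ?_
      rw [intervalIntegral.integral_const_mul, mul_comm]
    · intro k _
      exact (continuous_const.mul (Polynomial.continuous _)).intervalIntegrable _ _
  have hpi : IntervalIntegrable (fun x => p.eval x) MeasureTheory.volume 0 τ :=
    (Polynomial.continuous _).intervalIntegrable _ _
  have hdi : IntervalIntegrable (d 0) MeasureTheory.volume 0 τ :=
    ContinuousOn.intervalIntegrable (by rwa [uIcc_of_le hτ.1])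
  obtain ⟨x, hx, hmax⟩ := isCompact_Icc.exists_isMaxOn (nonempty_Icc.2 hτ.1)
    (hc.sub (Polynomial.continuous p).continuousOn).abs
  have hx' : x ∈ Icc 0 l := ⟨hx.1, hx.2.trans hτ.2⟩
  obtain ⟨ζ, hζ, he⟩ := exists_interpolation_error_eq hl hd hv hvm hx'
  refine ⟨ζ, hζ, ?_⟩
  rw [hsum, ← intervalIntegral.integral_sub hdi hpi]
  have hle := intervalIntegral.norm_integral_le_of_norm_le_const (a := 0) (b := τ)
    (f := fun s => d 0 s - p.eval s) (C := |d 0 x - p.eval x|) (by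
      intro s hs
      rw [uIoc_of_le hτ.1] at hs
      exact hmax (Ioc_subset_Icc_self hs))
  rw [Real.norm_eq_abs, sub_zero, abs_of_nonneg hτ.1, he, abs_mul, abs_div, Nat.abs_cast] at hle
  refine hle.trans ?_
  gcongr
  · exact hτ.1
  · exact hM x hx'

/-! ### Gegenbauer polynomials -/

theorem natCast_succ_add_pos {α : ℝ} (hα : -1 / 2 < α) (n : ℕ) : 0 < (n : ℝ) + 1 + 2 * α := by
  have := n.cast_nonneg (α := ℝ)
  linarith

theorem gegenbauer_succ_succ {α : ℝ} (hα : -1 / 2 < α) (n : ℕ) :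
    ((n : ℝ[X]) + 1 + 2 * C α) * gegenbauer α (n + 2) =
      2 * ((n : ℝ[X]) + 1 + C α) * X * gegenbauer α (n + 1) -
        ((n : ℝ[X]) + 1) * gegenbauer α n := by
  have h : ((n : ℝ[X]) + 1 + 2 * C α) = C ((n : ℝ) + 1 + 2 * α) := by simp [C_ofNat]
  rw [gegenbauer, h, ← mul_assoc, ← C_mul, mul_inv_cancel₀ (natCast_succ_add_pos hα n).ne']
  simp [C_ofNat]

theorem natCast_succ_add_ne_zero {α : ℝ} (hα : -1 / 2 < α) (n : ℕ) :
    ((n : ℝ[X]) + 1 + 2 * C α) ≠ 0 := by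
  have h : ((n : ℝ[X]) + 1 + 2 * C α) = C ((n : ℝ) + 1 + 2 * α) := by simp [C_ofNat]
  rw [h]
  exact C_ne_zero.2 (natCast_succ_add_pos hα n).ne'

theorem gegenbauer_derivative_pair {α : ℝ} (hα : -1 / 2 < α) (n : ℕ) :
    (1 - X ^ 2) * derivative (gegenbauer α n) =
        ((n : ℝ[X]) + 2 * C α) * (X * gegenbauer α n - gegenbauer α (n + 1)) ∧
      (1 - X ^ 2) * derivative (gegenbauer α (n + 1)) =
        ((n : ℝ[X]) + 1) * (gegenbauer α n - X * gegenbauer α (n + 1)) := by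
  induction n with
  | zero => simp [gegenbauer, pow_two]
  | succ n ih =>
    obtain ⟨h1, h2⟩ := ih
    have hrec := gegenbauer_succ_succ hα n
    have hdrec := congrArg derivative hrec
    simp only [derivative_mul, derivative_add, derivative_sub, derivative_natCast,
      derivative_one, derivative_C, derivative_X, derivative_ofNat] at hdrec
    refine ⟨?_, ?_⟩
    · push_cast
      linear_combination h2 + hrec
    · refine mul_left_cancel₀ (natCast_succ_add_ne_zero hα n) ?_
      push_cast
      linear_combination (1 - X ^ 2) * hdrec - ((n : ℝ[X]) + 1) * h1 +
        2 * ((n : ℝ[X]) + 1 + C α) * X * h2 + ((n : ℝ[X]) + 2) * X * hrec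

/-- `(1 - X²) G_n' = (n + 2α) (X G_n - G_{n+1})`. -/
theorem one_sub_sq_mul_derivative_gegenbauer {α : ℝ} (hα : -1 / 2 < α) (n : ℕ) :
    (1 - X ^ 2) * derivative (gegenbauer α n) =
      ((n : ℝ[X]) + 2 * C α) * (X * gegenbauer α n - gegenbauer α (n + 1)) :=
  (gegenbauer_derivative_pair hα n).1

/-- `(1 - X²) G_{n+1}' = (n + 1) (G_n - X G_{n+1})`. -/
theorem one_sub_sq_mul_derivative_gegenbauer_succ {α : ℝ} (hα : -1 / 2 < α) (n : ℕ) :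
    (1 - X ^ 2) * derivative (gegenbauer α (n + 1)) =
      ((n : ℝ[X]) + 1) * (gegenbauer α n - X * gegenbauer α (n + 1)) :=
  (gegenbauer_derivative_pair hα n).2

/-- The Gegenbauer differential equation. -/
theorem gegenbauer_ode {α : ℝ} (hα : -1 / 2 < α) (n : ℕ) :
    (1 - X ^ 2) * derivative (derivative (gegenbauer α n)) =
      (2 * C α + 1) * X * derivative (gegenbauer α n) -
        (n : ℝ[X]) * ((n : ℝ[X]) + 2 * C α) * gegenbauer α n := by
  cases n with
  | zero => simp [gegenbauer]
  | succ n =>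
    have h1 := one_sub_sq_mul_derivative_gegenbauer hα n
    have h2 := one_sub_sq_mul_derivative_gegenbauer_succ hα n
    have hX : (1 - X ^ 2 : ℝ[X]) ≠ 0 := by
      intro h
      have := congrArg (eval 0) h
      simp at this
    have h3 : ((n : ℝ[X]) + 1) * derivative (gegenbauer α n) =
        ((n : ℝ[X]) + 2 * C α) * (X * derivative (gegenbauer α (n + 1)) -
          ((n : ℝ[X]) + 1) * gegenbauer α (n + 1)) := by
      refine mul_left_cancel₀ hX ?_
      linear_combination ((n : ℝ[X]) + 1) * h1 - ((n : ℝ[X]) + 2 * C α) * X * h2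
    have hd := congrArg derivative h2
    simp only [derivative_mul, derivative_add, derivative_sub, derivative_natCast,
      derivative_one, derivative_X, derivative_X_pow] at hd
    push_cast
    simp only [Nat.cast_ofNat, map_ofNat] at hd
    linear_combination hd + h3

theorem eval_one_gegenbauer {α : ℝ} (hα : -1 / 2 < α) (n : ℕ) :
    (gegenbauer α n).eval 1 = 1 := by
  induction n with
  | zero => simp [gegenbauer]
  | succ n ih =>
    have h := congrArg (eval 1) (one_sub_sq_mul_derivative_gegenbauer_succ hα n)
    have hn : (n : ℝ) + 1 ≠ 0 := by positivity
    simp [ih, hn] at h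
    linarith

theorem sq_eval_neg_one_gegenbauer {α : ℝ} (hα : -1 / 2 < α) (n : ℕ) :
    (gegenbauer α n).eval (-1) ^ 2 = 1 := by
  induction n with
  | zero => simp [gegenbauer]
  | succ n ih =>
    have h := congrArg (eval (-1)) (one_sub_sq_mul_derivative_gegenbauer_succ hα n)
    have hn : (n : ℝ) + 1 ≠ 0 := by positivity
    simp [hn] at h
    have h' : (gegenbauer α (n + 1)).eval (-1) = -(gegenbauer α n).eval (-1) := by linarith
    rw [h', neg_sq, ih]

/-- The leading coefficient of `G_{n+1}`. -/
noncomputable def gegenbauerLead (α : ℝ) (n : ℕ) : ℝ :=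
  2 ^ n * Real.Gamma (n + 1 + α) * Real.Gamma (1 + 2 * α) /
    (Real.Gamma (1 + α) * Real.Gamma (n + 1 + 2 * α))

theorem gegenbauerLead_pos {α : ℝ} (hα : -1 / 2 < α) (n : ℕ) : 0 < gegenbauerLead α n := by
  have := n.cast_nonneg (α := ℝ)
  have h1 := Real.Gamma_pos_of_pos (s := n + 1 + α) (by linarith)
  have h2 := Real.Gamma_pos_of_pos (s := 1 + 2 * α) (by linarith)
  have h3 := Real.Gamma_pos_of_pos (s := 1 + α) (by linarith)
  have h4 := Real.Gamma_pos_of_pos (s := n + 1 + 2 * α) (by linarith)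
  unfold gegenbauerLead
  positivity

theorem gegenbauerLead_succ {α : ℝ} (hα : -1 / 2 < α) (n : ℕ) :
    ((n : ℝ) + 1 + 2 * α) * gegenbauerLead α (n + 1) =
      2 * ((n : ℝ) + 1 + α) * gegenbauerLead α n := by
  have := n.cast_nonneg (α := ℝ)
  have h3 := Real.Gamma_pos_of_pos (s := 1 + α) (by linarith)
  have h4 := Real.Gamma_pos_of_pos (s := n + 1 + 2 * α) (by linarith)
  have h5 : (0 : ℝ) < n + 1 + 2 * α := natCast_succ_add_pos hα n
  have e1 : (((n + 1 : ℕ) : ℝ) + 1 + α) = (n + 1 + α) + 1 := by push_cast; ring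
  have e2 : (((n + 1 : ℕ) : ℝ) + 1 + 2 * α) = (n + 1 + 2 * α) + 1 := by push_cast; ring
  unfold gegenbauerLead
  rw [e1, e2, Real.Gamma_add_one (by linarith), Real.Gamma_add_one h5.ne']
  field_simp
  ring

theorem natDegree_gegenbauer_le (α : ℝ) (n : ℕ) :
    (gegenbauer α n).natDegree ≤ n ∧ (gegenbauer α (n + 1)).natDegree ≤ n + 1 := by
  induction n with
  | zero => simp [gegenbauer]
  | succ n ih =>
    refine ⟨ih.2, ?_⟩
    rw [gegenbauer]
    refine (natDegree_C_mul_le _ _).trans ((natDegree_sub_le _ _).trans (max_le ?_ ?_))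
    · rw [mul_assoc]
      refine (natDegree_C_mul_le _ _).trans (natDegree_mul_le.trans ?_)
      rw [natDegree_X]
      omega
    · exact (natDegree_C_mul_le _ _).trans (ih.1.trans (by omega))

theorem coeff_gegenbauer_succ {α : ℝ} (hα : -1 / 2 < α) (n : ℕ) :
    (gegenbauer α (n + 1)).coeff (n + 1) = gegenbauerLead α n := by
  induction n with
  | zero =>
    have h2 := Real.Gamma_pos_of_pos (s := 1 + 2 * α) (by linarith)
    have h3 := Real.Gamma_pos_of_pos (s := 1 + α) (by linarith)
    simp only [gegenbauer, gegenbauerLead, zero_add, coeff_X_one, Nat.cast_zero, pow_zero, one_mul]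
    field_simp
    rw [div_self (by rw [mul_comm]; exact h2.ne')]
  | succ n ih =>
    have h0 : (gegenbauer α n).coeff (n + 2) = 0 :=
      coeff_eq_zero_of_natDegree_lt ((natDegree_gegenbauer_le α n).1.trans_lt (by omega))
    have h5 := natCast_succ_add_pos hα n
    rw [gegenbauer, coeff_C_mul, coeff_sub, mul_assoc, coeff_C_mul, coeff_C_mul, coeff_X_mul, ih,
      h0, inv_mul_eq_iff_eq_mul₀ h5.ne', gegenbauerLead_succ hα]
    ring

/-- `G_{n+1}` has `n + 1` zeros in `(-1, 1)`. -/
theorem exists_gegenbauer_zeros {α : ℝ} (hα : -1 / 2 < α) (n : ℕ) :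
    ∃ r : Fin (n + 1) → ℝ, StrictMono r ∧ (∀ i, r i ∈ Ioo (-1) 1) ∧
      ∀ i, (gegenbauer α (n + 1)).eval (r i) = 0 := by
  induction n with
  | zero =>
    refine ⟨fun _ => 0, fun i j h => absurd h (by fin_cases i; fin_cases j; simp), fun _ => by simp, fun _ => by simp [gegenbauer]⟩
  | succ n ih =>
    obtain ⟨r, hr, hrm, hr0⟩ := ih
    set p : ℝ := ((n : ℝ) + 1 + 2 * α) / 2 with hp
    have hp0 : 0 < p := by
      have := natCast_succ_add_pos hα n
      positivity
    let F : ℝ → ℝ := fun x => (1 - x ^ 2) ^ p * (gegenbauer α (n + 1)).eval x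
    let F' : ℝ → ℝ := fun x => (1 - x ^ 2) ^ (p - 1) * (-(2 * p)) * (gegenbauer α (n + 2)).eval x
    let z : Fin (n + 3) → ℝ := Fin.cons (-1) (Fin.snoc r 1)
    have hzlast : z (Fin.last _) = 1 := by
      rw [← Fin.succ_last]
      simp [z]
    have hz0 : z 0 = -1 := rfl
    have hz : StrictMono z := by
      refine Fin.strictMono_cons.2 ⟨fun i => ?_, ?_⟩
      · refine Fin.lastCases ?_ (fun j => ?_) i
        · simp
        · simpa using (hrm j).1
      · refine Fin.strictMono_iff_lt_succ.2 fun i => ?_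
        refine Fin.lastCases ?_ (fun j => ?_) i
        · simpa using (hrm _).2
        · rw [← Fin.castSucc_succ, Fin.snoc_castSucc, Fin.snoc_castSucc]
          exact hr Fin.castSucc_lt_succ
    have hF0 : ∀ i, F (z i) = 0 := by
      intro i
      refine Fin.cases ?_ (fun j => ?_) i
      · simp [F, hz0, Real.zero_rpow hp0.ne']
      · refine Fin.lastCases ?_ (fun j => ?_) j
        · simp [F, z, Real.zero_rpow hp0.ne']
        · simp [F, z, hr0]
    have hFc : Continuous F := by
      refine Continuous.mul (Continuous.rpow_const (by fun_prop) fun _ => Or.inr hp0.le) ?_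
      exact Polynomial.continuous _
    have hFd : ∀ x ∈ Ioo (-1 : ℝ) 1, HasDerivAt F (F' x) x := by
      intro x hx
      have hx1 : 0 < 1 - x ^ 2 := by nlinarith [hx.1, hx.2]
      have h1 : HasDerivAt (fun x : ℝ => 1 - x ^ 2) (-(2 * x)) x := by
        simpa using (hasDerivAt_pow 2 x).const_sub 1
      have h2 := (h1.rpow_const (p := p) (Or.inl hx1.ne')).mul
        ((gegenbauer α (n + 1)).hasDerivAt x)
      refine h2.congr_deriv ?_
      have h3 := congrArg (eval x) (one_sub_sq_mul_derivative_gegenbauer hα (n + 1))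
      have h4 : (1 - x ^ 2) ^ p = (1 - x ^ 2) ^ (p - 1) * (1 - x ^ 2) := by
        rw [← Real.rpow_add_one hx1.ne']
        simp
      simp at h3
      simp only [F']
      rw [h4, mul_assoc _ (1 - x ^ 2), h3, hp]
      ring
    obtain ⟨y, hy, hym, hy0⟩ := exists_strictMono_zeros_deriv hz hFc.continuousOn
      (F' := F') (by rwa [hz0, hzlast]) hF0
    rw [hz0, hzlast] at hym
    refine ⟨y, hy, hym, fun i => ?_⟩
    have hx1 : 0 < 1 - y i ^ 2 := by nlinarith [(hym i).1, (hym i).2]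
    have := hy0 i
    simpa [F', (Real.rpow_pos_of_pos hx1 _).ne', hp0.ne'] using this

/-- A function of Sonin type: its monotonicity bounds `G_n`. -/
noncomputable def sonin (α : ℝ) (n : ℕ) : ℝ[X] :=
  (n : ℝ[X]) * ((n : ℝ[X]) + 2 * C α) * gegenbauer α n ^ 2 +
    (1 - X ^ 2) * derivative (gegenbauer α n) ^ 2

theorem derivative_sonin {α : ℝ} (hα : -1 / 2 < α) (n : ℕ) :
    derivative (sonin α n) = 4 * C α * X * derivative (gegenbauer α n) ^ 2 := by
  have h := gegenbauer_ode hα n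
  simp only [sonin, derivative_mul, derivative_add, derivative_sub, derivative_natCast,
      derivative_one, derivative_C, derivative_X, derivative_ofNat, derivative_pow]
  simp only [Nat.cast_ofNat, map_ofNat]
  linear_combination 2 * derivative (gegenbauer α n) * h

theorem eval_sonin (α : ℝ) (n : ℕ) (x : ℝ) :
    (sonin α n).eval x = (n : ℝ) * (n + 2 * α) * (gegenbauer α n).eval x ^ 2 +
      (1 - x ^ 2) * (derivative (gegenbauer α n)).eval x ^ 2 := by
  simp [sonin]

theorem polynomial_monotoneOn {p : ℝ[X]} {a b : ℝ}
    (h : ∀ x ∈ Ioo a b, 0 ≤ (derivative p).eval x) :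
    MonotoneOn (fun x => p.eval x) (Icc a b) := by
  refine monotoneOn_of_deriv_nonneg (convex_Icc a b) p.continuous.continuousOn
    p.differentiable.differentiableOn fun x hx => ?_
  rw [interior_Icc] at hx
  rw [Polynomial.deriv]
  exact h x hx

theorem polynomial_antitoneOn {p : ℝ[X]} {a b : ℝ}
    (h : ∀ x ∈ Ioo a b, (derivative p).eval x ≤ 0) :
    AntitoneOn (fun x => p.eval x) (Icc a b) := by
  refine antitoneOn_of_deriv_nonpos (convex_Icc a b) p.continuous.continuousOn
    p.differentiable.differentiableOn fun x hx => ?_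
  rw [interior_Icc] at hx
  rw [Polynomial.deriv]
  exact h x hx

theorem abs_eval_gegenbauer_le_one {α : ℝ} (hα : 0 ≤ α) (n : ℕ) {x : ℝ}
    (hx : x ∈ Icc (-1) 1) : |(gegenbauer α (n + 1)).eval x| ≤ 1 := by
  have hα' : -1 / 2 < α := by linarith
  have hle : (sonin α (n + 1)).eval x ≤ ((n : ℝ) + 1) * (n + 1 + 2 * α) := by
    rcases le_total 0 x with h0 | h0
    · have h := polynomial_monotoneOn (p := sonin α (n + 1)) (a := 0) (b := 1) (fun y hy => by
        rw [derivative_sonin hα']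
        have := hy.1
        simp
        positivity) ⟨h0, hx.2⟩ ⟨zero_le_one, le_rfl⟩ hx.2
      simpa [eval_sonin, eval_one_gegenbauer hα'] using h
    · have h := polynomial_antitoneOn (p := sonin α (n + 1)) (a := -1) (b := 0) (fun y hy => by
        rw [derivative_sonin hα']
        have h1 := hy.2
        have : 0 ≤ 4 * α * (eval y (derivative (gegenbauer α (n + 1)))) ^ 2 := by positivity
        simp
        nlinarith) ⟨le_rfl, by norm_num⟩ ⟨hx.1, h0⟩ hx.1
      simpa [eval_sonin, sq_eval_neg_one_gegenbauer hα'] using h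
  rw [eval_sonin] at hle
  push_cast at hle
  have hx2 : 0 ≤ 1 - x ^ 2 := by nlinarith [hx.1, hx.2]
  have hpos : 0 < ((n : ℝ) + 1) * (n + 1 + 2 * α) := by positivity
  have h2 : 0 ≤ (1 - x ^ 2) * (derivative (gegenbauer α (n + 1))).eval x ^ 2 := by positivity
  rw [← sq_le_one_iff_abs_le_one]
  by_contra hcon
  push Not at hcon
  nlinarith

theorem sq_eval_gegenbauer_le {α : ℝ} (hα : -1 / 2 < α) (hα0 : α < 0) (n : ℕ) {x : ℝ}
    (hx : x ∈ Icc (-1) 1) :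
    ((n : ℝ) + 1) * (n + 1 + 2 * α) * (gegenbauer α (n + 1)).eval x ^ 2 ≤
      ((n : ℝ) + 1) * (n + 1 + 2 * α) * (gegenbauer α (n + 1)).eval 0 ^ 2 +
        (((n : ℝ) + 1) * (gegenbauer α n).eval 0) ^ 2 := by
  have hle : (sonin α (n + 1)).eval x ≤ (sonin α (n + 1)).eval 0 := by
    rcases le_total 0 x with h0 | h0
    · refine polynomial_antitoneOn (p := sonin α (n + 1)) (a := 0) (b := 1) (fun y hy => by
        rw [derivative_sonin hα]
        have h1 := hy.1
        have : 0 ≤ 4 * y * (eval y (derivative (gegenbauer α (n + 1)))) ^ 2 := by positivity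
        simp
        nlinarith) ⟨le_rfl, zero_le_one⟩ ⟨h0, hx.2⟩ h0
    · refine polynomial_monotoneOn (p := sonin α (n + 1)) (a := -1) (b := 0) (fun y hy => by
        rw [derivative_sonin hα]
        have h1 := mul_pos_of_neg_of_neg hα0 hy.2
        have : 0 ≤ 4 * (α * y) * (eval y (derivative (gegenbauer α (n + 1)))) ^ 2 := by positivity
        simp
        nlinarith) ⟨hx.1, h0⟩ ⟨by norm_num, le_rfl⟩ h0
  have hd := congrArg (eval 0) (one_sub_sq_mul_derivative_gegenbauer_succ hα n)
  simp at hd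
  rw [eval_sonin, eval_sonin, hd] at hle
  have hx2 : 0 ≤ 1 - x ^ 2 := by nlinarith [hx.1, hx.2]
  have h2 : 0 ≤ (1 - x ^ 2) * (derivative (gegenbauer α (n + 1))).eval x ^ 2 := by positivity
  push_cast at hle
  linarith

theorem eval_zero_gegenbauer_succ_succ {α : ℝ} (hα : -1 / 2 < α) (n : ℕ) :
    ((n : ℝ) + 1 + 2 * α) * (gegenbauer α (n + 2)).eval 0 =
      -(((n : ℝ) + 1) * (gegenbauer α n).eval 0) := by
  have h := congrArg (eval 0) (gegenbauer_succ_succ hα n)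
  simpa using h

theorem eval_zero_gegenbauer_odd {α : ℝ} (hα : -1 / 2 < α) (m : ℕ) :
    (gegenbauer α (2 * m + 1)).eval 0 = 0 := by
  induction m with
  | zero => simp [gegenbauer]
  | succ m ih =>
    have h := eval_zero_gegenbauer_succ_succ hα (2 * m + 1)
    rw [ih, mul_zero, neg_zero] at h
    exact (mul_eq_zero.1 h).resolve_left (natCast_succ_add_pos hα _).ne'

theorem ring_choose_add_sub_one (r : ℝ) (m : ℕ) :
    Ring.choose (r + m - 1) m = (ascPochhammer ℝ m).eval r / (m.factorial : ℝ) := by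
  rw [← Ring.multichoose_eq, eq_div_iff (by positivity), mul_comm, ← nsmul_eq_mul,
    Ring.factorial_nsmul_multichoose_eq_ascPochhammer, Polynomial.ascPochhammer_smeval_eq_eval]

theorem abs_eval_zero_gegenbauer_even {α : ℝ} (hα : -1 / 2 < α) (hα0 : α < 0) (m : ℕ) :
    |(gegenbauer α (2 * m)).eval 0| * |Real.Gamma (2 * m + 2 * α)| =
      |(ascPochhammer ℝ m).eval α| / (m.factorial : ℝ) * ((2 * m).factorial : ℝ) *
        |Real.Gamma (2 * α)| := by
  induction m with
  | zero => simp [gegenbauer]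
  | succ m ih =>
    have hm := m.cast_nonneg (α := ℝ)
    have h := congrArg abs (eval_zero_gegenbauer_succ_succ hα (2 * m))
    rw [abs_neg, abs_mul, abs_mul, abs_of_pos (natCast_succ_add_pos hα _),
      abs_of_pos (by positivity : (0 : ℝ) < ((2 * m : ℕ) : ℝ) + 1)] at h
    push_cast at h
    have hne : (2 * m + 2 * α : ℝ) ≠ 0 := by
      intro h0
      rcases Nat.eq_zero_or_pos m with rfl | hm'
      · simp at h0
        linarith
      · have : (1 : ℝ) ≤ m := by exact_mod_cast hm'
        linarith
    have hpos : (0 : ℝ) < 2 * m + 1 + 2 * α := by linarith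
    have e : (2 * ((m + 1 : ℕ) : ℝ) + 2 * α) = (2 * m + 2 * α) + 1 + 1 := by push_cast; ring
    rw [e, Real.Gamma_add_one (by linarith), Real.Gamma_add_one hne, abs_mul, abs_mul,
      abs_of_pos (by linarith : (0 : ℝ) < 2 * m + 2 * α + 1), ascPochhammer_succ_eval, abs_mul,
      Nat.factorial_succ, show 2 * (m + 1) = 2 * m + 1 + 1 by ring, Nat.factorial_succ,
      Nat.factorial_succ]
    have e2 : |2 * (m : ℝ) + 2 * α| = 2 * |α + m| := by
      rw [show 2 * (m : ℝ) + 2 * α = 2 * (α + m) by ring, abs_mul, abs_two]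
    rw [e2]
    push_cast
    have hm1 : (m : ℝ) + 1 ≠ 0 := by positivity
    have hf : (m.factorial : ℝ) ≠ 0 := by positivity
    calc _ = ((2 * m + 1 + 2 * α) * |(gegenbauer α (2 * m + 2)).eval 0|) * (2 * |α + m|) *
          |Real.Gamma (2 * m + 2 * α)| := by ring
      _ = (2 * m + 1) * (2 * |α + m|) *
          (|(gegenbauer α (2 * m)).eval 0| * |Real.Gamma (2 * m + 2 * α)|) := by rw [h]; ring
      _ = _ := by
        rw [ih]
        field_simp
        ring

/-- The case distinction in the bound of `G_{N+1}` on `[-1, 1]`. -/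
noncomputable def gegenbauerBound (α : ℝ) (N : ℕ) : ℝ :=
  if 0 ≤ α then Real.Gamma ((N : ℝ) + 2 * α + 1)
     else if Even N then
      -(2 * α * Ring.choose ((N : ℝ) / 2 + α) (N / 2) * ((N + 1).factorial : ℝ) *
          |Real.Gamma (2 * α)|) /
        Real.sqrt (((N : ℝ) + 1) * ((N : ℝ) + 2 * α + 1))
     else
      |Ring.choose (((N : ℝ) - 1) / 2 + α) ((N + 1) / 2)| * ((N + 1).factorial : ℝ) *
        |Real.Gamma (2 * α)|

theorem ring_choose_nonneg {α : ℝ} (hα : -1 / 2 < α) (m : ℕ) : 0 ≤ Ring.choose ((m : ℝ) + α) m := by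
  rw [show (m : ℝ) + α = (1 + α) + m - 1 by ring, ring_choose_add_sub_one]
  exact div_nonneg (ascPochhammer_pos m _ (by linarith)).le (by positivity)

theorem abs_eval_gegenbauer_mul_Gamma_le {α : ℝ} (hα : -1 / 2 < α) (N : ℕ) {x : ℝ}
    (hx : x ∈ Icc (-1) 1) :
    |(gegenbauer α (N + 1)).eval x| * Real.Gamma ((N : ℝ) + 2 * α + 1) ≤ gegenbauerBound α N := by
  have hN := N.cast_nonneg (α := ℝ)
  have hΓ := Real.Gamma_pos_of_pos (s := (N : ℝ) + 2 * α + 1) (by linarith)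
  have hpos : 0 < (N : ℝ) + 1 + 2 * α := by linarith
  unfold gegenbauerBound
  split_ifs with h0 heven
  · exact mul_le_of_le_one_left hΓ.le (abs_eval_gegenbauer_le_one h0 N hx)
  · push Not at h0
    obtain ⟨m, hm⟩ := heven
    obtain rfl : N = 2 * m := by omega
    have hsq := sq_eval_gegenbauer_le hα h0 (2 * m) hx
    rw [eval_zero_gegenbauer_odd hα] at hsq
    have hE := abs_eval_zero_gegenbauer_even hα h0 m
    have hne : (2 * m + 2 * α : ℝ) ≠ 0 := by
      intro h1
      rcases Nat.eq_zero_or_pos m with rfl | hm'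
      · simp at h1
        linarith
      · have : (1 : ℝ) ≤ m := by exact_mod_cast hm'
        linarith
    rw [le_div_iff₀ (Real.sqrt_pos.2 (by push_cast at hpos ⊢; nlinarith)), mul_right_comm]
    have hleft : |(gegenbauer α (2 * m + 1)).eval x| *
        Real.sqrt ((((2 * m : ℕ) : ℝ) + 1) * (((2 * m : ℕ) : ℝ) + 2 * α + 1)) ≤
          (2 * m + 1) * |(gegenbauer α (2 * m)).eval 0| := by
      refine abs_le_of_sq_le_sq' ?_ (by positivity) |>.2
      rw [mul_pow, Real.sq_sqrt (by push_cast at hpos ⊢; nlinarith), sq_abs, mul_pow, sq_abs]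
      push_cast at hsq ⊢
      linarith
    refine (mul_le_mul_of_nonneg_right hleft hΓ.le).trans (le_of_eq ?_)
    have e1 : (((2 * m : ℕ) : ℝ) + 2 * α + 1) = (2 * m + 2 * α) + 1 := by push_cast; ring
    have e2 : (((2 * m : ℕ) : ℝ) / 2 + α) = (1 + α) + m - 1 := by push_cast; ring
    have e3 : 2 * m / 2 = m := by omega
    rw [← abs_of_pos hΓ, e1, Real.Gamma_add_one hne, abs_mul, e2, e3, ring_choose_add_sub_one]
    have h7 := ascPochhammer_succ_eval m α
    have h8 : (ascPochhammer ℝ (m + 1)).eval α = α * (ascPochhammer ℝ m).eval (1 + α) := by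
      rw [ascPochhammer_succ_left]
      simp [add_comm]
    have h9 : |(ascPochhammer ℝ m).eval α| * |2 * m + 2 * α| =
        2 * (-α * (ascPochhammer ℝ m).eval (1 + α)) := by
      rw [show 2 * (m : ℝ) + 2 * α = 2 * (α + m) by ring, abs_mul, abs_two, mul_left_comm,
        ← abs_mul, ← h7, h8, abs_mul, abs_of_neg h0,
        abs_of_pos (ascPochhammer_pos m _ (by linarith))]
    calc _ = (2 * m + 1) * |2 * m + 2 * α| *
          (|(gegenbauer α (2 * m)).eval 0| * |Real.Gamma (2 * m + 2 * α)|) := by ring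
      _ = (2 * m + 1) * (|(ascPochhammer ℝ m).eval α| * |2 * m + 2 * α|) / (m.factorial : ℝ) *
          ((2 * m).factorial : ℝ) * |Real.Gamma (2 * α)| := by rw [hE]; ring
      _ = _ := by
        rw [h9, Nat.factorial_succ]
        push_cast
        ring
  · push Not at h0
    obtain ⟨m, hm⟩ := Nat.not_even_iff_odd.1 heven
    subst hm
    have hsq := sq_eval_gegenbauer_le hα h0 (2 * m + 1) hx
    rw [eval_zero_gegenbauer_odd hα, mul_zero, zero_pow two_ne_zero, add_zero] at hsq
    have hle : |(gegenbauer α (2 * m + 1 + 1)).eval x| ≤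
        |(gegenbauer α (2 * (m + 1))).eval 0| :=
      sq_le_sq.1 (le_of_mul_le_mul_left hsq (by positivity))
    refine (mul_le_mul_of_nonneg_right hle hΓ.le).trans (le_of_eq ?_)
    have e1 : (((2 * m + 1 : ℕ) : ℝ) + 2 * α + 1) = 2 * ((m + 1 : ℕ) : ℝ) + 2 * α := by
      push_cast; ring
    have e2 : ((((2 * m + 1 : ℕ) : ℝ) - 1) / 2 + α) = α + ((m + 1 : ℕ) : ℝ) - 1 := by
      push_cast; ring
    have e3 : (2 * m + 1 + 1) / 2 = m + 1 := by omega
    rw [← abs_of_pos hΓ, e1, abs_eval_zero_gegenbauer_even hα h0 (m + 1), e2, e3,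
      ring_choose_add_sub_one, abs_div, Nat.abs_cast]
    rfl

/-! ### The nodes -/

theorem eval_shiftedGegenbauer (l α : ℝ) (n : ℕ) (x : ℝ) :
    (shiftedGegenbauer l α n).eval x = (gegenbauer α n).eval (2 / l * x - 1) := by
  simp [shiftedGegenbauer, eval_comp]

theorem derivative_shiftedGegenbauer (l α : ℝ) (n : ℕ) :
    derivative (shiftedGegenbauer l α n) =
      C (2 / l) * (derivative (gegenbauer α n)).comp (C (2 / l) * X - 1) := by
  simp [shiftedGegenbauer, derivative_comp]

theorem derivative_derivative_shiftedGegenbauer (l α : ℝ) (n : ℕ) :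
    derivative (derivative (shiftedGegenbauer l α n)) =
      C (2 / l) ^ 2 * (derivative (derivative (gegenbauer α n))).comp (C (2 / l) * X - 1) := by
  rw [derivative_shiftedGegenbauer, derivative_C_mul, derivative_comp]
  simp
  ring

/-- The leading coefficient of the shifted Gegenbauer polynomial of degree `n + 1`. -/
noncomputable def shiftedLead (l α : ℝ) (n : ℕ) : ℝ := gegenbauerLead α n * (2 / l) ^ (n + 1)

theorem shiftedLead_pos {l α : ℝ} (hl : 0 < l) (hα : -1 / 2 < α) (n : ℕ) :
    0 < shiftedLead l α n := by
  have := gegenbauerLead_pos hα n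
  unfold shiftedLead
  positivity

theorem natDegree_gegenbauer_succ {α : ℝ} (hα : -1 / 2 < α) (n : ℕ) :
    (gegenbauer α (n + 1)).natDegree = n + 1 := by
  refine le_antisymm (natDegree_gegenbauer_le α n).2 (le_natDegree_of_ne_zero ?_)
  rw [coeff_gegenbauer_succ hα]
  exact (gegenbauerLead_pos hα n).ne'

theorem natDegree_leadingCoeff_shift {l : ℝ} (hl : 0 < l) :
    (C (2 / l) * X - 1 : ℝ[X]).natDegree = 1 ∧ (C (2 / l) * X - 1 : ℝ[X]).leadingCoeff = 2 / l := by
  have h : (C (2 / l) * X - 1 : ℝ[X]) = C (2 / l) * X + C (-1) := by simp [sub_eq_add_neg]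
  have h0 : 2 / l ≠ 0 := by positivity
  rw [h]
  exact ⟨natDegree_linear h0, leadingCoeff_linear h0⟩

theorem natDegree_shiftedGegenbauer_succ {l α : ℝ} (hl : 0 < l) (hα : -1 / 2 < α) (n : ℕ) :
    (shiftedGegenbauer l α (n + 1)).natDegree = n + 1 := by
  rw [shiftedGegenbauer, natDegree_comp, natDegree_gegenbauer_succ hα,
    (natDegree_leadingCoeff_shift hl).1, mul_one]

theorem leadingCoeff_shiftedGegenbauer_succ {l α : ℝ} (hl : 0 < l) (hα : -1 / 2 < α) (n : ℕ) :
    (shiftedGegenbauer l α (n + 1)).leadingCoeff = shiftedLead l α n := by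
  rw [shiftedGegenbauer, leadingCoeff_comp (by rw [(natDegree_leadingCoeff_shift hl).1]; simp),
    (natDegree_leadingCoeff_shift hl).2, natDegree_gegenbauer_succ hα, leadingCoeff,
    natDegree_gegenbauer_succ hα, coeff_gegenbauer_succ hα, shiftedLead]

theorem exists_shiftedGegenbauer_zeros {l α : ℝ} (hl : 0 < l) (hα : -1 / 2 < α) (n : ℕ) :
    ∃ r : Fin (n + 1) → ℝ, StrictMono r ∧ (∀ i, r i ∈ Ioo 0 l) ∧
      ∀ i, (shiftedGegenbauer l α (n + 1)).eval (r i) = 0 := by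
  obtain ⟨r, hr, hrm, hr0⟩ := exists_gegenbauer_zeros hα n
  refine ⟨fun i => (r i + 1) * (l / 2), fun i j h => ?_, fun i => ⟨?_, ?_⟩, fun i => ?_⟩
  · have := hr h
    simp only
    gcongr
  · have := (hrm i).1
    have : 0 < r i + 1 := by linarith
    positivity
  · have := (hrm i).2
    nlinarith
  · rw [eval_shiftedGegenbauer, ← hr0 i]
    congr 1
    field_simp
    ring

theorem roots_eq_map_of_zeros {p : ℝ[X]} {m : ℕ} (hp : p ≠ 0) (hdeg : p.natDegree = m)
    {r : Fin m → ℝ} (hr : Function.Injective r) (h0 : ∀ i, p.eval (r i) = 0) :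
    p.roots = (Finset.univ : Finset (Fin m)).val.map r := by
  symm
  refine Multiset.eq_of_le_of_card_le ?_ ?_
  · refine (Multiset.le_iff_subset (Finset.univ.nodup.map hr)).2 fun x hx => ?_
    obtain ⟨i, -, rfl⟩ := Multiset.mem_map.1 hx
    exact (mem_roots hp).2 (h0 i)
  · simpa [hdeg] using card_roots' p

theorem node_spec {l α : ℝ} (hl : 0 < l) (hα : -1 / 2 < α) (n : ℕ) :
    StrictMono (node l α n) ∧ (∀ i, node l α n i ∈ Ioo 0 l) ∧
      shiftedGegenbauer l α (n + 1) =
        C (shiftedLead l α n) * Lagrange.nodal Finset.univ (node l α n) := by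
  obtain ⟨r, hr, hrm, hr0⟩ := exists_shiftedGegenbauer_zeros hl hα n
  have hdeg := natDegree_shiftedGegenbauer_succ hl hα n
  have hne : shiftedGegenbauer l α (n + 1) ≠ 0 := by
    intro h
    simp [h] at hdeg
  have hroots := roots_eq_map_of_zeros hne hdeg hr.injective hr0
  have hsort : (shiftedGegenbauer l α (n + 1)).roots.sort = List.ofFn r := by
    refine List.Perm.eq_of_pairwise' (r := (· ≤ ·)) (Multiset.pairwise_sort _ _) ?_ ?_
    · exact hr.monotone.sortedLE_ofFn.pairwise
    · rw [← Multiset.coe_eq_coe, Multiset.sort_eq, hroots]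
      simp [List.ofFn_eq_map]
  have hnode : node l α n = r := by
    funext i
    rw [node, hsort, List.getD_eq_getElem _ _ (by rw [List.length_ofFn]; exact i.2),
      List.getElem_ofFn]
  refine ⟨hnode ▸ hr, hnode ▸ hrm, ?_⟩
  rw [hnode]
  have h := C_leadingCoeff_mul_prod_multiset_X_sub_C (p := shiftedGegenbauer l α (n + 1))
    (by rw [hroots, hdeg]; simp)
  rw [leadingCoeff_shiftedGegenbauer_succ hl hα, hroots, Multiset.map_map] at h
  exact h.symm

/-! ### The Christoffel numbers -/

theorem intervalIntegrable_weight {l α : ℝ} (hl : 0 < l) (hα : -1 / 2 < α) :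
    IntervalIntegrable (fun x : ℝ => (x * (l - x)) ^ (α - 1 / 2)) MeasureTheory.volume 0 l := by
  have hleft : IntervalIntegrable (fun x : ℝ => (x * (l - x)) ^ (α - 1 / 2))
      MeasureTheory.volume 0 (l / 2) := by
    have h1 : IntervalIntegrable (fun x : ℝ => x ^ (α - 1 / 2)) MeasureTheory.volume 0 (l / 2) :=
      intervalIntegral.intervalIntegrable_rpow' (by linarith)
    have h2 : ContinuousOn (fun x : ℝ => (l - x) ^ (α - 1 / 2)) (uIcc 0 (l / 2)) := by
      rw [uIcc_of_le (by positivity)]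
      refine ContinuousOn.rpow_const (by fun_prop) fun x hx => Or.inl ?_
      have := hx.2
      linarith
    refine (h1.mul_continuousOn h2).congr fun x hx => ?_
    rw [uIoc_of_le (by positivity)] at hx
    exact (Real.mul_rpow hx.1.le (by linarith [hx.2])).symm
  have hright := (hleft.comp_sub_left l).symm
  refine hleft.trans (c := l) ?_
  have e : l - l / 2 = l / 2 := by ring
  rw [sub_zero, e] at hright
  refine hright.congr fun x _ => ?_
  rw [sub_sub_cancel, mul_comm]

theorem intervalIntegrable_weight_mul {l α : ℝ} (hl : 0 < l) (hα : -1 / 2 < α) (q : ℝ[X]) :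
    IntervalIntegrable (fun x : ℝ => (x * (l - x)) ^ (α - 1 / 2) * q.eval x)
      MeasureTheory.volume 0 l :=
  (intervalIntegrable_weight hl hα).mul_continuousOn q.continuous.continuousOn

theorem integral_weight_mul_C_mul (l α a : ℝ) (q : ℝ[X]) :
    ∫ x in (0 : ℝ)..l, (x * (l - x)) ^ (α - 1 / 2) * (C a * q).eval x =
      a * ∫ x in (0 : ℝ)..l, (x * (l - x)) ^ (α - 1 / 2) * q.eval x := by
  rw [← intervalIntegral.integral_const_mul]
  congr 1
  funext x
  rw [eval_mul, eval_C]
  ring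

theorem integral_weight_mul_add {l α : ℝ} (hl : 0 < l) (hα : -1 / 2 < α) (p q : ℝ[X]) :
    ∫ x in (0 : ℝ)..l, (x * (l - x)) ^ (α - 1 / 2) * (p + q).eval x =
      (∫ x in (0 : ℝ)..l, (x * (l - x)) ^ (α - 1 / 2) * p.eval x) +
        ∫ x in (0 : ℝ)..l, (x * (l - x)) ^ (α - 1 / 2) * q.eval x := by
  rw [← intervalIntegral.integral_add (intervalIntegrable_weight_mul hl hα p)
    (intervalIntegrable_weight_mul hl hα q)]
  simp only [eval_add, mul_add]

theorem integral_weight_pos {l α : ℝ} (hl : 0 < l) (hα : -1 / 2 < α) :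
    0 < ∫ x in (0 : ℝ)..l, (x * (l - x)) ^ (α - 1 / 2) := by
  refine intervalIntegral.intervalIntegral_pos_of_pos_on (intervalIntegrable_weight hl hα)
    (fun x hx => ?_) hl
  have h1 := hx.1
  have h2 := sub_pos.2 hx.2
  positivity

/-- The Gegenbauer polynomials of positive degree are orthogonal to the constants. -/
theorem integral_weight_mul_shiftedGegenbauer {l α : ℝ} (hl : 0 < l) (hα : -1 / 2 < α) (n : ℕ) :
    ∫ x in (0 : ℝ)..l, (x * (l - x)) ^ (α - 1 / 2) *
      (shiftedGegenbauer l α (n + 1)).eval x = 0 := by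
  set P := shiftedGegenbauer l α (n + 1) with hP
  set c : ℝ := ((n : ℝ) + 1) * (n + 1 + 2 * α) with hc
  have hc0 : c ≠ 0 := (mul_pos (by positivity) (natCast_succ_add_pos hα n)).ne'
  have hcont : Continuous fun x : ℝ => (x * (l - x)) ^ (α + 1 / 2) * (derivative P).eval x := by
    refine Continuous.mul (Continuous.rpow_const (by fun_prop) fun _ => Or.inr (by linarith)) ?_
    exact Polynomial.continuous _
  have hd : ∀ x ∈ Ioo 0 l,
      HasDerivAt (fun x : ℝ => (x * (l - x)) ^ (α + 1 / 2) * (derivative P).eval x)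
        ((x * (l - x)) ^ (α - 1 / 2) * (C (-c) * P).eval x) x := by
    intro x hx
    have hx1 : 0 < x * (l - x) := mul_pos hx.1 (sub_pos.2 hx.2)
    have h1 : HasDerivAt (fun x : ℝ => x * (l - x)) (1 * (l - x) + x * (-1)) x :=
      (hasDerivAt_id x).mul ((hasDerivAt_id x).const_sub l)
    refine ((h1.rpow_const (p := α + 1 / 2) (Or.inl hx1.ne')).mul
      ((derivative P).hasDerivAt x)).congr_deriv ?_
    have h4 : (x * (l - x)) ^ (α + 1 / 2) = (x * (l - x)) ^ (α - 1 / 2) * (x * (l - x)) := by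
      rw [← Real.rpow_add_one hx1.ne']
      ring_nf
    have h5 : α + 1 / 2 - 1 = α - 1 / 2 := by ring
    have hode := congrArg (eval (2 / l * x - 1)) (gegenbauer_ode hα (n + 1))
    rw [h4, h5, hP, derivative_derivative_shiftedGegenbauer, derivative_shiftedGegenbauer]
    simp only [eval_mul, eval_sub, eval_one, eval_pow, eval_X, eval_add, eval_C, eval_natCast,
      eval_ofNat, eval_comp, Nat.cast_add, Nat.cast_one] at hode ⊢
    rw [← eval_shiftedGegenbauer] at hode
    generalize eval (2 / l * x - 1) (derivative (derivative (gegenbauer α (n + 1)))) = d2 at *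
    generalize eval (2 / l * x - 1) (derivative (gegenbauer α (n + 1))) = d1 at *
    have h6 : x * (l - x) * (2 / l) ^ 2 = 1 - (2 / l * x - 1) ^ 2 := by
      field_simp
      ring
    have h7 : (1 * (l - x) + x * -1) * (2 / l) = -2 * (2 / l * x - 1) := by
      field_simp
      ring
    linear_combination (x * (l - x)) ^ (α - 1 / 2) * ((α + 1 / 2) * d1 * h7 + d2 * h6 + hode)
  have h := intervalIntegral.integral_eq_sub_of_hasDerivAt_of_le hl.le hcont.continuousOn hd
    (intervalIntegrable_weight_mul hl hα _)
  have hz : (0 : ℝ) ^ (α + 1 / 2) = 0 := Real.zero_rpow (by linarith)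
  rw [integral_weight_mul_C_mul] at h
  simp only [sub_self, mul_zero, zero_mul, hz] at h
  exact (mul_eq_zero.1 h).resolve_left (neg_ne_zero.2 hc0)

/-- The kernel of Christoffel and Darboux integrates to a constant. -/
theorem exists_christoffelDarboux {l α : ℝ} (hl : 0 < l) (hα : -1 / 2 < α) (n : ℕ) :
    ∃ c > 0, ∀ y : ℝ, ∃ q : ℝ[X],
      (X - C y) * q =
        C ((shiftedGegenbauer l α n).eval y) * shiftedGegenbauer l α (n + 1) -
          C ((shiftedGegenbauer l α (n + 1)).eval y) * shiftedGegenbauer l α n ∧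
      ∫ x in (0 : ℝ)..l, (x * (l - x)) ^ (α - 1 / 2) * q.eval x = c := by
  induction n with
  | zero =>
    refine ⟨(∫ x in (0 : ℝ)..l, (x * (l - x)) ^ (α - 1 / 2)) * (2 / l),
      mul_pos (integral_weight_pos hl hα) (by positivity), fun y => ⟨C (2 / l), ?_, ?_⟩⟩
    · simp only [shiftedGegenbauer, gegenbauer, X_comp, one_comp, eval_one, eval_sub, eval_mul,
        eval_X, eval_C, map_one, map_sub, map_mul]
      ring
    · simp [intervalIntegral.integral_mul_const]
  | succ n ih =>
    obtain ⟨c, hc, ih⟩ := ih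
    have hpos := natCast_succ_add_pos hα n
    refine ⟨((n : ℝ) + 1 + 2 * α)⁻¹ * (((n : ℝ) + 1) * c), by positivity, fun y => ?_⟩
    obtain ⟨q, hq, hqi⟩ := ih y
    set P := shiftedGegenbauer l α (n + 1) with hP
    set P0 := shiftedGegenbauer l α n with hP0
    have hrec : shiftedGegenbauer l α (n + 2) = C (((n : ℝ) + 1 + 2 * α)⁻¹) *
        (C (2 * ((n : ℝ) + 1 + α)) * (C (2 / l) * X - 1) * P - C ((n : ℝ) + 1) * P0) := by
      simp only [hP, hP0, shiftedGegenbauer, gegenbauer, mul_comp, sub_comp, C_comp, X_comp]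
    refine ⟨C (((n : ℝ) + 1 + 2 * α)⁻¹) *
      (C (2 * ((n : ℝ) + 1 + α) * (2 / l) * P.eval y) * P + C ((n : ℝ) + 1) * q), ?_, ?_⟩
    · rw [hrec]
      simp only [eval_mul, eval_C, eval_sub, eval_X, eval_one, map_mul, map_sub, map_one]
      linear_combination C (((n : ℝ) + 1 + 2 * α)⁻¹) * C ((n : ℝ) + 1) * hq
    · rw [integral_weight_mul_C_mul, integral_weight_mul_add hl hα, integral_weight_mul_C_mul,
        integral_weight_mul_C_mul, hqi, integral_weight_mul_shiftedGegenbauer hl hα n]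
      ring

theorem exists_christoffel_eq {l α : ℝ} (hl : 0 < l) (hα : -1 / 2 < α) (n : ℕ) :
    ∃ c > 0, ∀ i, node l α n i * (l - node l α n i) * christoffel l α n i =
      c * Lagrange.nodalWeight Finset.univ (node l α n) i ^ 2 := by
  obtain ⟨hmono, hmem, hprod⟩ := node_spec hl hα n
  obtain ⟨c, hc, hcd⟩ := exists_christoffelDarboux hl hα n
  have hκ := shiftedLead_pos hl hα n
  set κ := shiftedLead l α n with hκdef
  refine ⟨((n : ℝ) + 1) * c * l / (2 * κ ^ 2), by positivity, fun i => ?_⟩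
  obtain ⟨q, hq, hqi⟩ := hcd (node l α n i)
  set x := node l α n i with hx
  set W := Lagrange.nodalWeight Finset.univ (node l α n) i with hW
  have hW0 : W ≠ 0 := Lagrange.nodalWeight_ne_zero hmono.injective.injOn (Finset.mem_univ i)
  set p := (shiftedGegenbauer l α n).eval x with hp
  set E := Lagrange.nodal (Finset.univ.erase i) (node l α n) with hE
  have hnod : Lagrange.nodal Finset.univ (node l α n) = (X - C x) * E :=
    Lagrange.nodal_eq_mul_nodal_erase (Finset.mem_univ i)
  have hroot : (shiftedGegenbauer l α (n + 1)).eval x = 0 := by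
    rw [hprod, hnod]
    simp
  have hqE : q = C (p * κ) * E := by
    refine mul_left_cancel₀ (X_sub_C_ne_zero x) ?_
    rw [hq, hroot, hprod, hnod]
    simp
    ring
  have hbasis : Lagrange.basis Finset.univ (node l α n) i = C W * E := by
    rw [Lagrange.basis_eq_prod_sub_inv_mul_nodal_div (Finset.mem_univ i),
      ← Lagrange.nodal_erase_eq_nodal_div (Finset.mem_univ i)]
  have h1 : p * κ * christoffel l α n i = W * c := by
    rw [← hqi, hqE, christoffel, hbasis]
    rw [integral_weight_mul_C_mul, integral_weight_mul_C_mul]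
    ring
  have hdW : (derivative (shiftedGegenbauer l α (n + 1))).eval x = κ * W⁻¹ := by
    rw [hprod, derivative_C_mul, eval_mul, eval_C, hW,
      Lagrange.nodalWeight_eq_eval_derivative_nodal (Finset.mem_univ i), inv_inv]
  have h2 : 2 / l * (x * (l - x)) * κ = ((n : ℝ) + 1) * p * W := by
    have h := congrArg (eval (2 / l * x - 1)) (one_sub_sq_mul_derivative_gegenbauer_succ hα n)
    rw [derivative_shiftedGegenbauer] at hdW
    simp [eval_comp] at hdW h
    rw [← eval_shiftedGegenbauer, ← eval_shiftedGegenbauer, hroot, mul_zero, sub_zero] at h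
    have h6 : x * (l - x) * (2 / l) ^ 2 = 1 - (2 / l * x - 1) ^ 2 := by
      field_simp
      ring
    rw [← h6] at h
    have h7 : κ = 2 / l * eval (2 / l * x - 1) (derivative (gegenbauer α (n + 1))) * W := by
      rw [hdW]
      field_simp
    rw [h7]
    linear_combination W * h
  have h3 : 2 / l * κ ^ 2 * (x * (l - x) * christoffel l α n i) = ((n : ℝ) + 1) * c * W ^ 2 := by
    linear_combination κ * christoffel l α n i * h2 + ((n : ℝ) + 1) * W * h1
  field_simp at h3 ⊢
  linear_combination h3

/-! ### The barycentric weights and the integration matrix -/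

theorem neg_one_pow_mul_abs_nodalWeight {n : ℕ} {v : Fin (n + 1) → ℝ} (hv : StrictMono v)
    (i : Fin (n + 1)) :
    (-1) ^ (i : ℕ) * |Lagrange.nodalWeight Finset.univ v i| =
      (-1) ^ n * Lagrange.nodalWeight Finset.univ v i := by
  have h : Lagrange.nodalWeight Finset.univ v i =
      (-1) ^ (n - i : ℕ) * |Lagrange.nodalWeight Finset.univ v i| := by
    have hfac : ∀ j ∈ Finset.univ.erase i,
        (v i - v j)⁻¹ = (if i < j then -1 else 1) * |(v i - v j)⁻¹| := by
      intro j hj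
      rcases lt_or_gt_of_ne (Finset.ne_of_mem_erase hj) with hlt | hlt
      · rw [if_neg hlt.not_gt, one_mul, abs_of_pos (inv_pos.2 (sub_pos.2 (hv hlt)))]
      · rw [if_pos hlt, abs_of_neg (inv_lt_zero.2 (sub_neg.2 (hv hlt)))]
        ring
    have hcard : (Finset.univ.erase i).filter (fun j => i < j) = Finset.Ioi i := by
      ext j
      simp only [Finset.mem_filter, Finset.mem_erase, Finset.mem_univ, Finset.mem_Ioi]
      exact ⟨fun h => h.2, fun h => ⟨⟨h.ne', trivial⟩, h⟩⟩
    rw [Lagrange.nodalWeight, Finset.abs_prod]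
    conv_lhs => rw [Finset.prod_congr rfl hfac, Finset.prod_mul_distrib, Finset.prod_ite,
      Finset.prod_const, Finset.prod_const_one, mul_one, hcard, Fin.card_Ioi]
    simp
  have hi : (i : ℕ) + (n - i) = n := by omega
  have hsq : ((-1 : ℝ) ^ (n - i : ℕ)) * (-1) ^ (n - i : ℕ) = 1 := by
    rw [← mul_pow]
    simp
  have hpow : (-1 : ℝ) ^ n = (-1) ^ (i : ℕ) * (-1) ^ (n - i : ℕ) := by rw [← pow_add, hi]
  conv_rhs => rw [h, hpow]
  linear_combination -(-1 : ℝ) ^ (i : ℕ) * |Lagrange.nodalWeight Finset.univ v i| * hsq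

/-- The barycentric weights are proportional to those of Lagrange interpolation. -/
theorem exists_baryWeight_eq {l α : ℝ} (hl : 0 < l) (hα : -1 / 2 < α) (n : ℕ) :
    ∃ η ≠ 0, ∀ i, baryWeight l α n i =
      η * Lagrange.nodalWeight Finset.univ (node l α n) i := by
  obtain ⟨c, hc, hch⟩ := exists_christoffel_eq hl hα n
  set k : ℝ := (4 : ℝ) ^ α * l ^ (-2 * (1 + α)) with hk
  have hk0 : 0 < k := by positivity
  refine ⟨2 * Real.sqrt (k * c) * (-1) ^ n, ?_, fun i => ?_⟩
  · have := Real.sqrt_pos.2 (mul_pos hk0 hc)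
    exact mul_ne_zero (by positivity) (by simp)
  · have h : k * (l - node l α n i) * node l α n i * christoffel l α n i =
        (k * c) * Lagrange.nodalWeight Finset.univ (node l α n) i ^ 2 := by
      linear_combination k * hch i
    rw [baryWeight, ← hk, h, Real.sqrt_mul (by positivity), Real.sqrt_sq_eq_abs]
    linear_combination 2 * Real.sqrt (k * c) *
      neg_one_pow_mul_abs_nodalWeight (node_spec hl hα n).1 i

theorem baryLagrange_eq_eval_basis {l α : ℝ} (hl : 0 < l) (hα : -1 / 2 < α) (n : ℕ)
    (k : Fin (n + 1)) {x : ℝ} (hx : ∀ i, x ≠ node l α n i) :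
    baryLagrange l α n k x = (Lagrange.basis Finset.univ (node l α n) k).eval x := by
  obtain ⟨η, hη, hw⟩ := exists_baryWeight_eq hl hα n
  have hinj := (node_spec hl hα n).1.injective.injOn 
    (s := ((Finset.univ : Finset (Fin (n + 1))) : Set (Fin (n + 1))))
  have h1 := Lagrange.eval_interpolate_not_at_node' (r := fun j => if j = k then (1 : ℝ) else 0)
    hinj Finset.univ_nonempty (fun i _ => hx i)
  have h2 : Lagrange.interpolate Finset.univ (node l α n) (fun j => if j = k then (1 : ℝ) else 0) =
      Lagrange.basis Finset.univ (node l α n) k := by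
    simp [Lagrange.interpolate_apply]
  rw [← h2, h1, baryLagrange]
  simp only [hw, mul_ite, mul_one, mul_zero, Finset.sum_ite_eq', Finset.mem_univ, if_true,
    mul_div_assoc, ← Finset.mul_sum, ← div_eq_mul_inv]
  rw [← mul_div_assoc]
  exact mul_div_mul_left _ _ hη

theorem integMatrixOne_eq {l α : ℝ} (hl : 0 < l) (hα : -1 / 2 < α) (n : ℕ)
    (i k : Fin (n + 1)) :
    integMatrixOne l α n i k =
      ∫ x in (0 : ℝ)..(node l α n i), (Lagrange.basis Finset.univ (node l α n) k).eval x := by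
  refine intervalIntegral.integral_congr_ae ?_
  have h : ∀ᵐ x ∂(MeasureTheory.volume : MeasureTheory.Measure ℝ), x ∉ range (node l α n) :=
    MeasureTheory.measure_eq_zero_iff_ae_notMem.1 ((finite_range _).measure_zero _)
  filter_upwards [h] with x hx _
  exact baryLagrange_eq_eval_basis hl hα n k fun i hi => hx ⟨i, hi.symm⟩

/-! ### The error bounds -/

theorem abs_prod_sub_node_le {l α : ℝ} (hl : 0 < l) (hα : -1 / 2 < α) (N : ℕ) {x : ℝ}
    (hx : x ∈ Icc 0 l) :
    |∏ i, (x - node l α N i)| ≤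
      gegenbauerBound α N / (Real.Gamma ((N : ℝ) + 2 * α + 1) * shiftedLead l α N) := by
  have hN := N.cast_nonneg (α := ℝ)
  have hκ := shiftedLead_pos hl hα N
  have hΓ := Real.Gamma_pos_of_pos (s := (N : ℝ) + 2 * α + 1) (by linarith)
  have h := congrArg (eval x) (node_spec hl hα N).2.2
  rw [eval_shiftedGegenbauer, eval_mul, eval_C, Lagrange.eval_nodal] at h
  have hs : 2 / l * x - 1 ∈ Icc (-1 : ℝ) 1 := by
    have h1 : 0 ≤ 2 / l * x := mul_nonneg (by positivity) hx.1
    have h2 : 2 / l * x ≤ 2 / l * l := mul_le_mul_of_nonneg_left hx.2 (by positivity)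
    rw [div_mul_cancel₀ _ hl.ne'] at h2
    exact ⟨by linarith, by linarith⟩
  have hG := abs_eval_gegenbauer_mul_Gamma_le hα N hs
  rw [h, abs_mul, abs_of_pos hκ] at hG
  rw [le_div_iff₀ (by positivity)]
  linarith

theorem inv_Gamma_mul_shiftedLead {l α : ℝ} (hl : 0 < l) (hα : -1 / 2 < α) (N : ℕ) :
    1 / (Real.Gamma ((N : ℝ) + 2 * α + 1) * shiftedLead l α N) =
      constD α * ((4 : ℝ)⁻¹ ^ N * l ^ (N + 1) / Real.Gamma ((N : ℝ) + α + 1)) := by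
  have hN := N.cast_nonneg (α := ℝ)
  have h1 := Real.Gamma_pos_of_pos (s := (N : ℝ) + α + 1) (by linarith)
  have h2 := Real.Gamma_pos_of_pos (s := 1 + 2 * α) (by linarith)
  have h3 := Real.Gamma_pos_of_pos (s := 1 + α) (by linarith)
  have h4 := Real.Gamma_pos_of_pos (s := (N : ℝ) + 2 * α + 1) (by linarith)
  have e1 : (N : ℝ) + 1 + α = N + α + 1 := by ring
  have e2 : (N : ℝ) + 1 + 2 * α = N + 2 * α + 1 := by ring
  have e4 : (4 : ℝ) ^ N = 2 ^ N * 2 ^ N := by rw [← mul_pow]; norm_num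
  rw [shiftedLead, gegenbauerLead, constD, e1, e2, div_pow, inv_pow, e4, pow_succ (2 : ℝ)]
  generalize Real.Gamma ((N : ℝ) + α + 1) = g1 at *
  generalize Real.Gamma (1 + 2 * α) = g2 at *
  generalize Real.Gamma (1 + α) = g3 at *
  generalize Real.Gamma ((N : ℝ) + 2 * α + 1) = g4 at *
  field_simp

theorem constD_mul_eps1 {l α : ℝ} (hl : 0 < l) (hα : -1 / 2 < α) (N : ℕ) (B t : ℝ) :
    constD α * eps1 α l N B t =
      B / ((N + 1).factorial : ℝ) *
        (gegenbauerBound α N / (Real.Gamma ((N : ℝ) + 2 * α + 1) * shiftedLead l α N)) * t := by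
  have h : eps1 α l N B t = (4 : ℝ)⁻¹ ^ N * B * l ^ (N + 1) * t /
      (((N + 1).factorial : ℝ) * Real.Gamma ((N : ℝ) + α + 1)) * gegenbauerBound α N := rfl
  rw [h, div_eq_mul_one_div (gegenbauerBound α N), inv_Gamma_mul_shiftedLead hl hα N]
  have hf : ((N + 1).factorial : ℝ) ≠ 0 := by positivity
  generalize Real.Gamma ((N : ℝ) + α + 1) = g
  field_simp

theorem constD_mul_eps2 {l α : ℝ} (hl : 0 < l) (hα : -1 / 2 < α) (N : ℕ) (A m y : ℝ) :
    constD α * eps2 α l N A m y =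
      A * m * 2 ^ (N + 1) / ((N + 1).factorial : ℝ) *
        (gegenbauerBound α N / (Real.Gamma ((N : ℝ) + 2 * α + 1) * shiftedLead l α N)) * y := by
  have hN := N.cast_nonneg (α := ℝ)
  have hΓ := Real.Gamma_pos_of_pos (s := (N : ℝ) + 2 * α + 1) (by linarith)
  have e1 : 1 + (N : ℝ) + α = N + α + 1 := by ring
  have h2 : (2 : ℝ) ^ (1 - (N : ℤ)) = (4 : ℝ)⁻¹ ^ N * 2 ^ (N + 1) := by
    rw [zpow_sub₀ two_ne_zero, zpow_one, zpow_natCast, inv_pow,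
      show (4 : ℝ) ^ N = 2 ^ N * 2 ^ N by rw [← mul_pow]; norm_num, pow_succ]
    field_simp
  have h : eps2 α l N A m y = A * m * ((4 : ℝ)⁻¹ ^ N * 2 ^ (N + 1)) * y * l ^ (N + 1) /
      (((N + 1).factorial : ℝ) * Real.Gamma ((N : ℝ) + α + 1)) * gegenbauerBound α N := by
    rw [eps2, gegenbauerBound, h2, e1]
    split_ifs with h0 heven
    · ring
    · push Not at h0
      have hc : 0 ≤ Ring.choose ((N : ℝ) / 2 + α) (N / 2) := by
        obtain ⟨m, rfl⟩ := heven
        have e2 : ((m + m : ℕ) : ℝ) / 2 = m := by push_cast; ring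
        rw [e2, show (m + m) / 2 = m by omega]
        exact ring_choose_nonneg hα m
      rw [abs_of_neg h0, abs_of_nonneg hc]
      field_simp
    · field_simp
  rw [h, div_eq_mul_one_div (gegenbauerBound α N), inv_Gamma_mul_shiftedLead hl hα N]
  have hf : ((N + 1).factorial : ℝ) ≠ 0 := by positivity
  generalize Real.Gamma ((N : ℝ) + α + 1) = g
  field_simp

theorem gegenbauerBound_nonneg {α : ℝ} (hα : -1 / 2 < α) (N : ℕ) : 0 ≤ gegenbauerBound α N := by
  have hN := N.cast_nonneg (α := ℝ)
  have hΓ := Real.Gamma_pos_of_pos (s := (N : ℝ) + 2 * α + 1) (by linarith)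
  exact (mul_nonneg (abs_nonneg _) hΓ.le).trans
    (abs_eval_gegenbauer_mul_Gamma_le hα N (x := 0) (by simp))

/-- The error of the first-order integration matrix. -/
theorem exists_abs_integMatrixOne_error_le {l α : ℝ} (hl : 0 < l) (hα : -1 / 2 < α) {N : ℕ}
    {d : ℕ → ℝ → ℝ}
    (hd : ∀ k ≤ N, ∀ x ∈ Icc 0 l, HasDerivWithinAt (d k) (d (k + 1) x) (Icc 0 l) x)
    (i : Fin (N + 1)) :
    ∃ ζ ∈ Ioo 0 l,
      |(∫ x in (0 : ℝ)..node l α N i, d 0 x) -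
          ∑ k, integMatrixOne l α N i k * d 0 (node l α N k)| ≤
        |d (N + 1) ζ| / ((N + 1).factorial : ℝ) *
          (gegenbauerBound α N / (Real.Gamma ((N : ℝ) + 2 * α + 1) * shiftedLead l α N)) *
            node l α N i := by
  obtain ⟨hmono, hmem, -⟩ := node_spec hl hα N
  simp only [integMatrixOne_eq hl hα]
  exact exists_abs_quadrature_error_le hl hd hmono.injective
    (fun k => Ioo_subset_Icc_self (hmem k)) (fun x hx => abs_prod_sub_node_le hl hα N hx)
    (Ioo_subset_Icc_self (hmem i))

theorem integral_integral_eq_of_continuous {g : ℝ → ℝ} (hg : Continuous g) (y : ℝ) :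
    ∫ s in (0 : ℝ)..y, ∫ r in (0 : ℝ)..s, g r = ∫ s in (0 : ℝ)..y, (y - s) * g s := by
  have hH : ∀ s, HasDerivAt (fun s => ∫ r in (0 : ℝ)..s, g r) (g s) s := fun s =>
    (hg.integral_hasStrictDerivAt 0 s).hasDerivAt
  have h := intervalIntegral.integral_mul_deriv_eq_deriv_mul (a := 0) (b := y)
    (u := fun s => y - s) (u' := fun _ => -1) (fun s _ => (hasDerivAt_id s).const_sub y)
    (fun s _ => hH s) (continuous_const.intervalIntegrable _ _) (hg.intervalIntegrable _ _)
  rw [h]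
  simp

/-- Cauchy's formula for the twice iterated integral. -/
theorem iterInt_two_eq {g : ℝ → ℝ} {y : ℝ} (hy : 0 ≤ y) (hg : ContinuousOn g (Icc 0 y)) :
    iterInt 2 g y = ∫ s in (0 : ℝ)..y, (y - s) * g s := by
  have hext : Continuous (IccExtend hy ((Icc 0 y).domRestrict g)) :=
    (continuousOn_iff_continuous_domRestrict.1 hg).Icc_extend'
  have heq : ∀ s ∈ Icc 0 y, g s = IccExtend hy ((Icc 0 y).domRestrict g) s := fun s hs => by
    rw [IccExtend_of_mem hy _ hs, domRestrict_apply]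
  have h := integral_integral_eq_of_continuous hext y
  have h1 : ∫ s in (0 : ℝ)..y, (y - s) * g s =
      ∫ s in (0 : ℝ)..y, (y - s) * IccExtend hy ((Icc 0 y).domRestrict g) s := by
    refine intervalIntegral.integral_congr fun s hs => ?_
    rw [uIcc_of_le hy] at hs
    simp only [heq s hs]
  rw [h1, ← h]
  refine intervalIntegral.integral_congr fun s hs => ?_
  rw [uIcc_of_le hy] at hs
  refine intervalIntegral.integral_congr fun r hr => ?_
  rw [uIcc_of_le hs.1] at hr
  exact heq r ⟨hr.1, hr.2.trans hs.2⟩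

theorem hasDerivWithinAt_iteratedDerivWithin {g : ℝ → ℝ} {s : Set ℝ} {k : ℕ}
    (h : DifferentiableOn ℝ (iteratedDerivWithin k g s) s) {x : ℝ} (hx : x ∈ s) :
    HasDerivWithinAt (iteratedDerivWithin k g s) (iteratedDerivWithin (k + 1) g s x) s x := by
  rw [iteratedDerivWithin_succ]
  exact (h x hx).hasDerivWithinAt

/-- The error of the second-order integration matrix. -/
theorem exists_abs_integMatrix_two_error_le {l α : ℝ} (hl : 0 < l) (hα : -1 / 2 < α) {N : ℕ}
    {g : ℝ → ℝ}
    (hg : ∀ k ≤ N, DifferentiableOn ℝ (iteratedDerivWithin k g (Icc 0 l)) (Icc 0 l))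
    {A : ℝ} (hA : 0 ≤ A)
    (hgA : ∀ k ≤ N + 1, ∀ y ∈ Icc 0 l, |iteratedDerivWithin k g (Icc 0 l) y| ≤ A)
    (i : Fin (N + 1)) :
    ∃ ζ ∈ Ioo 0 l,
      |iterInt 2 g (node l α N i) - ∑ k, integMatrix l α N 2 i k * g (node l α N k)| ≤
        constD α * eps2 α l N A (nMax (node l α N i) ζ) (node l α N i) := by
  have hymem := (node_spec hl hα N).2.1 i
  set y := node l α N i with hy
  let d : ℕ → ℝ → ℝ := fun k s => (y - s) * iteratedDerivWithin k g (Icc 0 l) s -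
    k * iteratedDerivWithin (k - 1) g (Icc 0 l) s
  have hd : ∀ k ≤ N, ∀ x ∈ Icc 0 l, HasDerivWithinAt (d k) (d (k + 1) x) (Icc 0 l) x := by
    intro k hk x hx
    have h1 := (((hasDerivAt_id x).const_sub y).hasDerivWithinAt (s := Icc 0 l)).mul
      (hasDerivWithinAt_iteratedDerivWithin (hg k hk) hx)
    cases k with
    | zero =>
      refine (h1.sub ((hasDerivWithinAt_iteratedDerivWithin (hg 0 hk) hx).const_mul
        ((0 : ℕ) : ℝ))).congr_deriv ?_
      simp [d]
      ring
    | succ k =>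
      refine (h1.sub ((hasDerivWithinAt_iteratedDerivWithin (hg k (by omega)) hx).const_mul
        ((k + 1 : ℕ) : ℝ))).congr_deriv ?_
      simp [d]
      ring
  obtain ⟨ζ, hζ, he⟩ := exists_abs_integMatrixOne_error_le hl hα hd i
  refine ⟨ζ, hζ, ?_⟩
  have hd0 : ∀ s, d 0 s = (y - s) * g s := fun s => by simp [d]
  have hc : ContinuousOn g (Icc 0 y) := by
    have := (hg 0 (Nat.zero_le _)).continuousOn
    rw [iteratedDerivWithin_zero] at this
    exact this.mono (Icc_subset_Icc_right hymem.2.le)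
  have hsum : ∑ k, integMatrix l α N 2 i k * g (node l α N k) =
      ∑ k, integMatrixOne l α N i k * d 0 (node l α N k) := by
    refine Finset.sum_congr rfl fun k _ => ?_
    rw [hd0, integMatrix]
    simp [← hy]
    ring
  rw [iterInt_two_eq hymem.1.le hc, hsum]
  simp only [← hd0]
  rw [constD_mul_eps2 hl hα]
  refine he.trans ?_
  have hm1 : 1 ≤ nMax y ζ := le_max_left _ _
  have hm2 : |y - ζ| ≤ nMax y ζ := le_max_right _ _
  have hdb : |d (N + 1) ζ| ≤ A * nMax y ζ * 2 ^ (N + 1) := by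
    have hb1 := hgA (N + 1) le_rfl ζ (Ioo_subset_Icc_self hζ)
    have hb2 := hgA N (Nat.le_succ N) ζ (Ioo_subset_Icc_self hζ)
    have hpow : (N : ℝ) + 1 + 1 ≤ 2 ^ (N + 1) := by
      exact_mod_cast (Nat.lt_two_pow_self (n := N + 1))
    have hN := N.cast_nonneg (α := ℝ)
    have h1 : |d (N + 1) ζ| ≤ |y - ζ| * A + ((N : ℝ) + 1) * A := by
      refine (abs_sub _ _).trans ?_
      rw [abs_mul, abs_mul, Nat.abs_cast]
      simp only [Nat.add_sub_cancel]
      push_cast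
      gcongr
    calc |d (N + 1) ζ| ≤ |y - ζ| * A + ((N : ℝ) + 1) * A := h1
      _ ≤ nMax y ζ * A + ((N : ℝ) + 1) * (A * nMax y ζ) := by
        gcongr
        exact le_mul_of_one_le_right hA hm1
      _ = A * nMax y ζ * (N + 1 + 1) := by ring
      _ ≤ _ := by gcongr
  have hΓ := Real.Gamma_pos_of_pos (s := (N : ℝ) + 2 * α + 1)
    (by have := N.cast_nonneg (α := ℝ); linarith)
  have hM := div_nonneg (gegenbauerBound_nonneg hα N)
    (mul_pos hΓ (shiftedLead_pos hl hα N)).le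
  have hy0 := hymem.1.le
  gcongr

/-- The error of the integration matrix of first order. -/
theorem exists_abs_integMatrix_one_error_le {l α : ℝ} (hl : 0 < l) (hα : -1 / 2 < α) {N : ℕ}
    {g : ℝ → ℝ} (hg : ContDiffOn ℝ ((N + 1 : ℕ) : ℕ∞) g (Icc 0 l)) (i : Fin (N + 1)) :
    ∃ ζ ∈ Ioo 0 l,
      |iterInt 1 g (node l α N i) - ∑ k, integMatrix l α N 1 i k * g (node l α N k)| ≤
        constD α * eps1 α l N |iteratedDerivWithin (N + 1) g (Icc 0 l) ζ| (node l α N i) := by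
  obtain ⟨ζ, hζ, he⟩ := exists_abs_integMatrixOne_error_le hl hα
    (d := fun k => iteratedDerivWithin k g (Icc 0 l))
    (fun k hk x hx => hasDerivWithinAt_iteratedDerivWithin
      (hg.differentiableOn_iteratedDerivWithin (by exact_mod_cast Nat.lt_succ_of_le hk)
        (uniqueDiffOn_Icc hl)) hx) i
  refine ⟨ζ, hζ, ?_⟩
  rw [constD_mul_eps1 hl hα]
  simpa [iterInt, integMatrix] using he

theorem constD_mul_eps1_mono {l α : ℝ} (hl : 0 < l) (hα : -1 / 2 < α) (N : ℕ) {B B' t : ℝ}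
    (hB : B ≤ B') (ht : 0 ≤ t) : constD α * eps1 α l N B t ≤ constD α * eps1 α l N B' t := by
  have hΓ := Real.Gamma_pos_of_pos (s := (N : ℝ) + 2 * α + 1)
    (by have := N.cast_nonneg (α := ℝ); linarith)
  have hM := div_nonneg (gegenbauerBound_nonneg hα N)
    (mul_pos hΓ (shiftedLead_pos hl hα N)).le
  rw [constD_mul_eps1 hl hα, constD_mul_eps1 hl hα]
  gcongr

theorem constD_mul_eps2_mono {l α : ℝ} (hl : 0 < l) (hα : -1 / 2 < α) (N : ℕ) {A m m' y : ℝ}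
    (hA : 0 ≤ A) (hm : m ≤ m') (hy : 0 ≤ y) :
    constD α * eps2 α l N A m y ≤ constD α * eps2 α l N A m' y := by
  have hΓ := Real.Gamma_pos_of_pos (s := (N : ℝ) + 2 * α + 1)
    (by have := N.cast_nonneg (α := ℝ); linarith)
  have hM := div_nonneg (gegenbauerBound_nonneg hα N)
    (mul_pos hΓ (shiftedLead_pos hl hα N)).le
  rw [constD_mul_eps2 hl hα, constD_mul_eps2 hl hα]
  gcongr

end BSGPM

theorem mainTheorem6
    (L tf α : ℝ) (hL : 0 < L) (htf : 0 < tf) (hα : -1 / 2 < α)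
    (Ny Nt : ℕ) (hNy : 1 ≤ Ny) (hNt : 1 ≤ Nt)
    (f : ℝ → ℝ) (φ u : ℝ → ℝ → ℝ)
    -- `ψ(y, ·)` is of class `C^{Nt+1}` on `[0, tf]` for every `y ∈ [0, L]`
    (hψ : ∀ y ∈ Set.Icc 0 L,
      ContDiffOn ℝ ((Nt + 1 : ℕ) : ℕ∞) (fun t => BSGPM.psi φ u y t) (Set.Icc 0 tf))
    -- the `y`-derivatives of `φ` up to order `Ny + 1` exist on `[0, L] × [0, tf]` ...
    (hφ : ∀ t ∈ Set.Icc 0 tf, ∀ k ≤ Ny,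
      DifferentiableOn ℝ (iteratedDerivWithin k (fun y => φ y t) (Set.Icc 0 L)) (Set.Icc 0 L))
    -- ... and are bounded by `A`
    (A : ℝ) (hA : 0 < A)
    (hφA : ∀ k ≤ Ny + 1, ∀ y ∈ Set.Icc 0 L, ∀ t ∈ Set.Icc 0 tf,
      |iteratedDerivWithin k (fun s => φ s t) (Set.Icc 0 L) y| ≤ A) :
    ∃ (ζy : Fin (Ny + 1) → ℝ) (ζt : Fin (Nt + 1) → ℝ),
      (∀ i, ζy i ∈ Set.Ioo 0 L) ∧ (∀ j, ζt j ∈ Set.Ioo 0 tf) ∧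
      ∀ B : Fin (Nt + 1) → ℝ, (∀ j, 0 < B j) →
        (∀ j, ∀ y ∈ Set.Icc 0 L,
          |iteratedDerivWithin (Nt + 1) (fun t => BSGPM.psi φ u y t) (Set.Icc 0 tf) (ζt j)|
            ≤ B j) →
        ∀ (i : Fin (Ny + 1)) (j : Fin (Nt + 1)),
          |BSGPM.totalError L tf α Ny Nt f φ u i j| ≤
            BSGPM.constD α *
              (BSGPM.eps1 α tf Nt (B j) (BSGPM.node tf α Nt j) +
                BSGPM.eps2 α L Ny A
                  (BSGPM.nMax (BSGPM.node L α Ny i) (ζy i)) (BSGPM.node L α Ny i)) := by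
  obtain ⟨-, hymem, -⟩ := BSGPM.node_spec hL hα Ny
  obtain ⟨-, htmem, -⟩ := BSGPM.node_spec htf hα Nt
  choose ζy hζy hEy using fun (i : Fin (Ny + 1)) (j : Fin (Nt + 1)) =>
    BSGPM.exists_abs_integMatrix_two_error_le hL hα
      (hφ _ (Ioo_subset_Icc_self (htmem j))) hA.le
      (fun k hk y hy => hφA k hk y hy _ (Ioo_subset_Icc_self (htmem j))) i
  choose ζt hζt hEt using fun (i : Fin (Ny + 1)) (j : Fin (Nt + 1)) =>
    BSGPM.exists_abs_integMatrix_one_error_le htf hα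
      (hψ _ (Ioo_subset_Icc_self (hymem i))) j
  choose jmax hjmax using fun i : Fin (Ny + 1) =>
    Finite.exists_max fun j : Fin (Nt + 1) => BSGPM.nMax (BSGPM.node L α Ny i) (ζy i j)
  choose imax himax using fun j : Fin (Nt + 1) =>
    Finite.exists_max fun i : Fin (Ny + 1) =>
      |BSGPM.iterInt 1 (fun t => BSGPM.psi φ u (BSGPM.node L α Ny i) t) (BSGPM.node tf α Nt j) -
        ∑ k, BSGPM.integMatrix tf α Nt 1 j k *
          BSGPM.psi φ u (BSGPM.node L α Ny i) (BSGPM.node tf α Nt k)|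
  refine ⟨fun i => ζy i (jmax i), fun j => ζt (imax j) j, fun i => hζy _ _, fun j => hζt _ _,
    fun B _ hB i j => ?_⟩
  have hy := (hEy i j).trans
    (BSGPM.constD_mul_eps2_mono hL hα Ny hA.le (hjmax i j) (hymem i).1.le)
  have ht := ((himax j i).trans (hEt (imax j) j)).trans
    (BSGPM.constD_mul_eps1_mono htf hα Nt
      (hB j _ (Ioo_subset_Icc_self (hymem (imax j)))) (htmem j).1.le)
  rw [mul_add, add_comm]
  refine le_trans (le_of_eq ?_) ((abs_add_le _ _).trans (add_le_add hy ht))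
  rw [BSGPM.totalError, BSGPM.integralResidual, BSGPM.discreteResidual]
  congr 1
  ring
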